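/- There are absolute constants $C, c > 0$ such that the following holds for every real $\epsilon>0$. There is an algorithm that, given a tree $T$ of order $n$ and a function $w:V(T)\to\mathbb{Z}_{\ge 0}$, determines a connected $w$-safe set $S$ of $T$ with $w(S)\le(1+\epsilon)\,cs(T,w)$ in at most $$C\cdot\max\{1,1/\epsilon\}^4\cdot n^{\,c\max\{1,1/\epsilon\}}$$ steps; for $\epsilon\le 1$ this is a running time of $O\left(\epsilon^{-4}n^{O(1/\epsilon)}\right)$, with constants that do not depend on $\epsilon$, $T$ or $w$. Here $w(U)=\sum_{u\in U}w(u)$ for a set $U$ of vertices. A set $S\subseteq V(T)$ is $w$-safe if $w(V(C))\ge w(V(D))$ for every component $C$ of $T[S]$ and every component $D$ of $T-S$ such that some vertex of $C$ is adjacent to some vertex of $D$. The set $S$ is connected if it is nonempty and $T[S]$ is connected. The connected safe number $cs(T,w)$ is the minimum of $w(S)$ over all connected $w$-safe sets $S$ of $T$. Algorithms are programs for a random access machine over the natural numbers with uniform cost, whose operations are constants, reading and writing of memory cells with computed addresses, addition, truncated subtraction and comparison, each counting one step; $T$ is given by its adjacency matrix and $w$ by the list of its values. -/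

import Mathlib

/-! Weighted graphs and (connected) safe sets. -/

namespace SafeSet

open Classical in
/-- The `w`-weight of a set `U` of vertices. -/
noncomputable def weight {V : Type*} [Fintype V] (w : V → ℕ) (U : Set V) : ℕ :=
  ∑ v ∈ Finset.univ.filter (fun v => v ∈ U), w v

/-- `S` is `w`-safe in `G`: whenever a component `C` of `G[S]` and a component `D` of `G - S` are
adjacent, the weight of `D` is at most the weight of `C`. -/
def IsSafe {V : Type*} [Fintype V] (G : SimpleGraph V) (w : V → ℕ) (S : Set V) : Prop :=
  ∀ (C : (G.induce S).ConnectedComponent) (D : (G.induce Sᶜ).ConnectedComponent),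
    (∃ u ∈ C.supp, ∃ v ∈ D.supp, G.Adj (u : V) (v : V)) →
      weight w (Subtype.val '' D.supp) ≤ weight w (Subtype.val '' C.supp)

/-- `S` is a connected `w`-safe set: it is `w`-safe and induces a connected (in particular
nonempty) subgraph. -/
def IsConnectedSafe {V : Type*} [Fintype V] (G : SimpleGraph V) (w : V → ℕ) (S : Set V) : Prop :=
  (G.induce S).Connected ∧ IsSafe G w S

/-- The connected safe number `cs(G, w)`: the minimum weight of a connected `w`-safe set.
For a connected graph the set below is nonempty, as it contains the weight of the set of all
vertices, so that the infimum is a minimum. -/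
noncomputable def cs {V : Type*} [Fintype V] (G : SimpleGraph V) (w : V → ℕ) : ℕ :=
  sInf {m | ∃ S : Set V, IsConnectedSafe G w S ∧ weight w S = m}

end SafeSet

/-! A random access machine with the uniform cost measure, programmed by structured programs.
The memory consists of arrays of natural numbers (of unbounded size), named by natural numbers;
the name of an array is part of the program text, whereas the index may be computed.
The only arithmetic operations are addition and truncated subtraction. -/

namespace Ram

/-- A memory: `σ a i` is the content of cell `i` of array `a`. -/
abbrev Memory : Type := ℕ → ℕ → ℕ

/-- Expressions. -/
inductive Expr : Type
  | const (k : ℕ)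
  | read (a : ℕ) (index : Expr)
  | add (e₁ e₂ : Expr)
  | sub (e₁ e₂ : Expr)

/-- The value of an expression. -/
def Expr.eval (σ : Memory) : Expr → ℕ
  | .const k => k
  | .read a e => σ a (e.eval σ)
  | .add e₁ e₂ => e₁.eval σ + e₂.eval σ
  | .sub e₁ e₂ => e₁.eval σ - e₂.eval σ

/-- The number of elementary operations for evaluating an expression: each constant, memory
access, addition and subtraction counts one. -/
def Expr.cost : Expr → ℕ
  | .const _ => 1
  | .read _ e => e.cost + 1
  | .add e₁ e₂ => e₁.cost + e₂.cost + 1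
  | .sub e₁ e₂ => e₁.cost + e₂.cost + 1

/-- Programs. -/
inductive Program : Type
  /-- do nothing -/
  | skip
  /-- store the value of `e` in cell `index` of array `a` -/
  | write (a : ℕ) (index e : Expr)
  /-- first `p`, then `q` -/
  | seq (p q : Program)
  /-- if `e₁ < e₂` then `p` else `q` -/
  | ifLt (e₁ e₂ : Expr) (p q : Program)
  /-- while `e₁ < e₂` do `p` -/
  | whileLt (e₁ e₂ : Expr) (p : Program)

/-- Overwrite a single memory cell. -/
def Memory.set (σ : Memory) (a i x : ℕ) : Memory :=
  fun b j => if b = a ∧ j = i then x else σ b j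

/-- `Exec p σ τ t`: program `p`, started with memory `σ`, halts with memory `τ` after exactly
`t` elementary steps. Besides the evaluation of its expressions, every write, every `skip` and
every test costs one step. -/
inductive Exec : Program → Memory → Memory → ℕ → Prop
  | skip (σ : Memory) : Exec .skip σ σ 1
  | write (σ : Memory) (a : ℕ) (i e : Expr) :
      Exec (.write a i e) σ (σ.set a (i.eval σ) (e.eval σ)) (i.cost + e.cost + 1)
  | seq (p q : Program) (σ τ υ : Memory) (s t : ℕ) (hp : Exec p σ τ s) (hq : Exec q τ υ t) :
      Exec (.seq p q) σ υ (s + t)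
  | ifTrue (e₁ e₂ : Expr) (p q : Program) (σ τ : Memory) (t : ℕ)
      (h : e₁.eval σ < e₂.eval σ) (hp : Exec p σ τ t) :
      Exec (.ifLt e₁ e₂ p q) σ τ (e₁.cost + e₂.cost + 1 + t)
  | ifFalse (e₁ e₂ : Expr) (p q : Program) (σ τ : Memory) (t : ℕ)
      (h : ¬ e₁.eval σ < e₂.eval σ) (hq : Exec q σ τ t) :
      Exec (.ifLt e₁ e₂ p q) σ τ (e₁.cost + e₂.cost + 1 + t)
  | whileTrue (e₁ e₂ : Expr) (p : Program) (σ τ υ : Memory) (s t : ℕ)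
      (h : e₁.eval σ < e₂.eval σ) (hp : Exec p σ τ s) (hw : Exec (.whileLt e₁ e₂ p) τ υ t) :
      Exec (.whileLt e₁ e₂ p) σ υ (e₁.cost + e₂.cost + 1 + s + t)
  | whileFalse (e₁ e₂ : Expr) (p : Program) (σ : Memory)
      (h : ¬ e₁.eval σ < e₂.eval σ) :
      Exec (.whileLt e₁ e₂ p) σ σ (e₁.cost + e₂.cost + 1)

open Classical in
/-- The initial memory for a graph `G` on the vertices `0, …, n - 1` with vertex weights `w`:
array `0` holds `n` in its cell `0`, array `1` holds the weights, array `2` holds the adjacency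
matrix row by row, and everything else is `0`. -/
noncomputable def input {n : ℕ} (G : SimpleGraph (Fin n)) (w : Fin n → ℕ) : Memory
  | 0, i => if i = 0 then n else 0
  | 1, i => if h : i < n then w ⟨i, h⟩ else 0
  | 2, i => if ∃ u v : Fin n, G.Adj u v ∧ i = n * (u : ℕ) + (v : ℕ) then 1 else 0
  | _, _ => 0

/-- The set of vertices returned in a final memory: array `3` holds its characteristic vector. -/
def output (n : ℕ) (σ : Memory) : Set (Fin n) :=
  {v | σ 3 (v : ℕ) ≠ 0}

end Ram

/-! Put k = ⌈max(1, 1/ε)⌉ and let O be an optimal connected safe set. At most k vertices of O weigh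
more than w(O)/k, and the remaining vertices of O weigh at most w(r) ≤ w(O)/k for a suitable r in O
(`exists_heavy`). The algorithm guesses r and a k-tuple of vertices of O listing the heavy ones, by
trying all choices; let H be the set of entries of the tuple.

For one guess, let p be w increased on H by some B > w(V). A set S grows from {r}: each step adds a
neighbor of S that is in H or weighs at most w(r), choosing one whose component of T - S has maximum
p-weight. For a correct guess there are two phases (`greedyInv_insert`). While some component of T -
S has p-weight above w(O), S stays inside O: if a neighbor v of S ⊆ O is not in O, acyclicity makes
its component miss O (`disjoint_comp`), so that it lies in a component of T - O
(`comp_subset_comp`), carries no penalty and weighs at most w(O). Once all components have p-weight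
at most w(O), all of H lies in S, and every further vertex weighs at most w(O)/k. As soon as w(S) ≥
w(O), the set S is safe; just before that w(S) < w(O), so the last vertex gives at most (1 + 1/k)
w(O).

Every S met on the way is tested by comparing the p-weights of the components with w(S). As w ≤ p,
passing the test implies safety, so wrong guesses do no harm, and the lightest set that passes is
kept (`run_step`, `run_greedy`, `run_search`).

The algorithm is written in a language of counting loops, which has a total semantics and a
syntactic time bound and compiles into the random access machine (`exec_compile`, `time_le`). There
are k + 1 loops for the guesses and five nested loops for the greedy algorithm, hence O(k) n^(k+6)
steps. -/

namespace SafeSet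

/-! ### Weights, components and connected safe sets. -/

section Weight

variable {V : Type*} [Fintype V] {w p : V → ℕ} {U W : Set V}

theorem weight_mono (h : U ⊆ W) : weight w U ≤ weight w W := by
  classical
  unfold weight
  refine Finset.sum_le_sum_of_subset ?_
  intro v hv
  simp only [Finset.mem_filter, Finset.mem_univ, true_and] at hv ⊢
  exact h hv

theorem weight_mono_fun (h : ∀ v ∈ U, w v ≤ p v) : weight w U ≤ weight p U := by
  classical
  unfold weight
  refine Finset.sum_le_sum fun v hv => ?_
  simp only [Finset.mem_filter, Finset.mem_univ, true_and] at hv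
  exact h v hv

theorem le_weight {v : V} (h : v ∈ U) : w v ≤ weight w U := by
  classical
  unfold weight
  exact Finset.single_le_sum (f := w) (fun _ _ => Nat.zero_le _) (by simpa using h)

open Classical in
theorem weight_eq_sum_ite (w : V → ℕ) (U : Set V) :
    weight w U = ∑ v, if v ∈ U then w v else 0 :=
  Finset.sum_filter _ _

theorem weight_insert_le (v : V) : weight w (insert v U) ≤ weight w U + w v := by
  classical
  have h : w v = ∑ x, if x = v then w x else 0 := by simp
  rw [weight_eq_sum_ite, weight_eq_sum_ite, h, ← Finset.sum_add_distrib]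
  refine Finset.sum_le_sum fun x _ => ?_
  by_cases h1 : x = v <;> by_cases h2 : x ∈ U <;> simp [h1, h2]

end Weight

variable {V : Type*}

/-- The graph obtained from `G` by removing all edges that meet `S`. -/
def outside (G : SimpleGraph V) (S : Set V) : SimpleGraph V where
  Adj a b := G.Adj a b ∧ a ∉ S ∧ b ∉ S
  symm := ⟨fun _ _ h => ⟨h.1.symm, h.2.2, h.2.1⟩⟩
  loopless := ⟨fun _ h => h.1.ne rfl⟩

/-- For `v ∉ S`, the vertex set of the component of `G - S` that contains `v`. -/
def comp (G : SimpleGraph V) (S : Set V) (v : V) : Set V :=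
  {x | (outside G S).Reachable v x}

variable {G : SimpleGraph V} {S S' : Set V} {u v x : V}

theorem self_mem_comp : v ∈ comp G S v := SimpleGraph.Reachable.refl v

theorem comp_subset_of_mem (h : x ∈ comp G S v) : comp G S v ⊆ comp G S x :=
  fun _ hy => h.symm.trans hy

theorem outside_anti (h : S ⊆ S') : outside G S' ≤ outside G S :=
  fun _ _ hab => ⟨hab.1, fun ha => hab.2.1 (h ha), fun hb => hab.2.2 (h hb)⟩

theorem comp_anti (h : S ⊆ S') : comp G S' v ⊆ comp G S v :=
  fun _ hx => hx.mono (outside_anti h)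

theorem notMem_of_mem_comp (hv : v ∉ S) (hx : x ∈ comp G S v) : x ∉ S := by
  obtain ⟨p⟩ := hx.symm
  cases p with
  | nil => exact hv
  | cons h _ => exact h.2.1

/-- Links the components of the induced graph to reachability in `outside G S`, which lives on all
of `V` and avoids subtypes. -/
theorem image_supp_eq_comp (v : ↥Sᶜ) :
    Subtype.val '' ((G.induce Sᶜ).connectedComponentMk v).supp = comp G S v := by
  ext x
  constructor
  · rintro ⟨y, hy, rfl⟩
    have hy : (G.induce Sᶜ).Reachable y v := SimpleGraph.ConnectedComponent.exact hy
    exact (hy.map (⟨Subtype.val, fun {a b} hab => ⟨hab, a.2, b.2⟩⟩ :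
      G.induce Sᶜ →g outside G S)).symm
  · intro hx
    have key : ∀ {a b : V} (_ : (outside G S).Walk a b) (ha : a ∈ Sᶜ),
        ∃ hb : b ∈ Sᶜ, (G.induce Sᶜ).Reachable ⟨a, ha⟩ ⟨b, hb⟩ := by
      intro a b q
      induction q with
      | nil => exact fun ha => ⟨ha, SimpleGraph.Reachable.refl _⟩
      | cons h q ih =>
        intro ha
        obtain ⟨hb, hr⟩ := ih h.2.2
        refine ⟨hb, SimpleGraph.Reachable.trans (SimpleGraph.Adj.reachable ?_) hr⟩
        exact h.1
    obtain ⟨q⟩ := hx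
    obtain ⟨hb, hr⟩ := key q v.2
    exact ⟨⟨x, hb⟩, SimpleGraph.ConnectedComponent.sound hr.symm, rfl⟩

theorem exists_adj_of_notMem (hG : G.Connected) (hS : S.Nonempty) (hv : v ∉ S) :
    ∃ x ∈ comp G S v, x ∉ S ∧ ∃ u ∈ S, G.Adj u x := by
  obtain ⟨s, hs⟩ := hS
  obtain ⟨q⟩ := hG.preconnected v s
  induction q with
  | nil => exact absurd hs hv
  | @cons a b c h q ih =>
    by_cases hb : b ∈ S
    · exact ⟨a, self_mem_comp, hv, b, hb, h.symm⟩
    · obtain ⟨x, hx, hxS, hu⟩ := ih hb hs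
      have hab : (outside G S).Adj a b := ⟨h, hv, hb⟩
      exact ⟨x, hab.reachable.trans hx, hxS, hu⟩

/-- A connected `S` is its own only component, and since `G` is connected every component of `G - S`
has an edge to `S`; the adjacency condition of safety thus disappears. -/
theorem isConnectedSafe_iff [Fintype V] {w : V → ℕ} (hG : G.Connected) :
    IsConnectedSafe G w S ↔
      (G.induce S).Connected ∧ ∀ v ∉ S, weight w (comp G S v) ≤ weight w S := by
  refine and_congr_right fun hS => ?_
  have hC : ∀ C : (G.induce S).ConnectedComponent, Subtype.val '' C.supp = S := by
    intro C
    induction C using SimpleGraph.ConnectedComponent.ind with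
    | h s =>
      ext x
      constructor
      · rintro ⟨y, _, rfl⟩
        exact y.2
      · exact fun hx => ⟨⟨x, hx⟩, SimpleGraph.ConnectedComponent.sound (hS.preconnected _ _), rfl⟩
  constructor
  · intro h v hv
    obtain ⟨⟨s, hs⟩⟩ := hS.nonempty
    obtain ⟨x, hx, hxS, u, hu, hux⟩ := exists_adj_of_notMem hG ⟨s, hs⟩ hv
    have := h ((G.induce S).connectedComponentMk ⟨u, hu⟩)
      ((G.induce Sᶜ).connectedComponentMk ⟨x, hxS⟩) ⟨⟨u, hu⟩, rfl, ⟨x, hxS⟩, rfl, hux⟩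
    rw [hC, image_supp_eq_comp] at this
    exact (weight_mono (comp_subset_of_mem hx)).trans this
  · intro h C D _
    rw [hC]
    induction D using SimpleGraph.ConnectedComponent.ind with
    | h v =>
      rw [image_supp_eq_comp]
      exact h v v.2

theorem connected_insert (hS : (G.induce S).Connected) (hu : u ∈ S) (h : G.Adj u v) :
    (G.induce (insert v S)).Connected := by
  have : insert v S = S ∪ {u, v} := by
    ext x
    simp only [Set.mem_insert_iff, Set.mem_union, Set.mem_singleton_iff]
    constructor
    · tauto
    · rintro (h | rfl | rfl) <;> tauto
  rw [this]
  exact SimpleGraph.induce_union_connected hS.preconnected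
    (SimpleGraph.induce_pair_connected_of_adj h).preconnected
    ⟨u, hu, by simp⟩

theorem exists_adj_of_not_subset {O : Set V} (hO : (G.induce O).Connected) (hu : u ∈ O)
    (huS : u ∈ S) (h : ¬ O ⊆ S) : ∃ v ∈ O, v ∉ S ∧ ∃ a ∈ S, G.Adj a v := by
  obtain ⟨x, hx, hxS⟩ := Set.not_subset.1 h
  obtain ⟨q⟩ := hO.preconnected ⟨u, hu⟩ ⟨x, hx⟩
  have key : ∀ {a b : O} (_ : (G.induce O).Walk a b), a.1 ∈ S → b.1 ∉ S →
      ∃ v ∈ O, v ∉ S ∧ ∃ a ∈ S, G.Adj a v := by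
    intro a b q
    induction q with
    | nil => exact fun ha hb => absurd ha hb
    | @cons a c b h q ih =>
      intro ha hb
      by_cases hc : c.1 ∈ S
      · exact ih hc hb
      · exact ⟨c, c.2, hc, a, ha, h⟩
  exact key q huS hxS

/-- In a forest uv is a bridge. Without it, `O` stays connected to u, as v is not in `O`, and the
component of v stays connected to v, as u is in `S`; so the two lie on different sides. -/
theorem disjoint_comp (hT : G.IsAcyclic) {O : Set V} (hO : (G.induce O).Connected)
    (hu : u ∈ O) (huS : u ∈ S) (hvO : v ∉ O) (h : G.Adj u v) :
    Disjoint (comp G S v) O := by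
  rw [Set.disjoint_left]
  intro x hx hxO
  have hb := (SimpleGraph.isBridge_iff.1
    (SimpleGraph.isAcyclic_iff_forall_adj_isBridge.1 hT h))
  have h1 : (G \ SimpleGraph.fromEdgeSet {s(u, v)}).Reachable u x := by
    refine (hO.preconnected ⟨u, hu⟩ ⟨x, hxO⟩).map
      (⟨Subtype.val, fun {a b} hab => ⟨hab, fun he => ?_⟩⟩ :
        G.induce O →g G \ SimpleGraph.fromEdgeSet {s(u, v)})
    have ha := a.2
    have hb := b.2
    simp only [SimpleGraph.fromEdgeSet_adj, Set.mem_singleton_iff, Sym2.eq_iff] at he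
    rcases he.1 with ⟨_, h⟩ | ⟨h, _⟩
    · exact hvO (h ▸ hb)
    · exact hvO (h ▸ ha)
  have h2 : (G \ SimpleGraph.fromEdgeSet {s(u, v)}).Reachable v x := by
    refine SimpleGraph.Reachable.mono ?_ hx
    intro a b hab
    refine ⟨hab.1, fun he => ?_⟩
    simp only [SimpleGraph.fromEdgeSet_adj, Set.mem_singleton_iff, Sym2.eq_iff] at he
    rcases he.1 with ⟨h, _⟩ | ⟨_, h⟩
    · exact hab.2.1 (h ▸ huS)
    · exact hab.2.2 (h ▸ huS)
  exact hb (h1.trans h2.symm)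

theorem comp_subset_comp {O : Set V} (h : Disjoint (comp G S v) O) :
    comp G S v ⊆ comp G O v := by
  have key : ∀ {a b : V} (_ : (outside G S).Walk a b), a ∈ comp G S v →
      (outside G O).Reachable a b := by
    intro a b q
    induction q with
    | nil => exact fun _ => SimpleGraph.Reachable.refl _
    | @cons a c b hac q ih =>
      intro ha
      have hc : c ∈ comp G S v := SimpleGraph.Reachable.trans ha hac.reachable
      have : (outside G O).Adj a c :=
        ⟨hac.1, Set.disjoint_left.1 h ha, Set.disjoint_left.1 h hc⟩
      exact this.reachable.trans (ih hc)
  rintro x ⟨q⟩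
  exact key q self_mem_comp

/-- The vertices at distance at most `i` from `v`. -/
def ball (G : SimpleGraph V) (v : V) : ℕ → Set V
  | 0 => {v}
  | i + 1 => ball G v i ∪ {b | ∃ a ∈ ball G v i, G.Adj a b}

theorem ball_mono (G : SimpleGraph V) (v : V) : Monotone (ball G v) :=
  monotone_nat_of_le_succ fun _ _ => Or.inl

theorem mem_ball_length : ∀ {x v : V} (q : G.Walk x v), x ∈ ball G v q.length
  | _, _, .nil => rfl
  | _, _, .cons h q => Or.inr ⟨_, mem_ball_length q, h.symm⟩

/-- The vertices that may be added to `S` by the greedy algorithm: those in the neighborhood of `S`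
whose weight is at most `θ`, unless the penalized weight `p` exceeds `w`. -/
def Eligible (G : SimpleGraph V) (w p : V → ℕ) (θ : ℕ) (S : Set V) (v : V) : Prop :=
  v ∉ S ∧ (∃ u ∈ S, G.Adj u v) ∧ w v + w v ≤ θ + p v

/-! ### Analysis of the greedy algorithm. -/

section Greedy

variable [Fintype V]

/-- The invariant of the greedy algorithm, compared with a connected safe set `O`. -/
def GreedyInv (G : SimpleGraph V) (w p : V → ℕ) (k : ℕ) (O : Set V) (r : V) (S : Set V) : Prop :=
  r ∈ S ∧ k * weight w S ≤ (k + 1) * weight w O ∧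
    (S ⊆ O ∨ ∀ v ∉ S, weight p (comp G S v) ≤ weight w O)

/-- The heart of the approximation: for a correct guess, a set that fails the test can be extended,
and the greedy choice keeps the invariant. The two cases are the late phase, where all components
are light, and the early phase, where `S` is still inside `O`. -/
theorem greedyInv_insert (hT : G.IsTree) {w p : V → ℕ} {k B : ℕ} {O H : Set V} {r : V}
    (hO : IsConnectedSafe G w O) (hH : H ⊆ O) (hrO : r ∈ O)
    (hpH : ∀ v ∈ H, p v = w v + B) (hpw : ∀ v ∉ H, p v = w v) (hB : weight w Set.univ < B)
    (hgood : ∀ v ∈ O, v ∈ H ∨ (w v ≤ w r ∧ k * w r ≤ weight w O))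
    (hS : GreedyInv G w p k O r S) (hfail : ¬ ∀ v ∉ S, weight p (comp G S v) ≤ weight w S) :
    (∃ v, Eligible G w p (w r) S v) ∧
      ∀ b, Eligible G w p (w r) S b →
        (∀ v, Eligible G w p (w r) S v → weight p (comp G S v) ≤ weight p (comp G S b)) →
        GreedyInv G w p k O r (insert b S) := by
  obtain ⟨hrS, hwS, hcase⟩ := hS
  have hO' := (isConnectedSafe_iff hT.connected).1 hO
  have hOB : weight w O < B := (weight_mono (Set.subset_univ _)).trans_lt hB
  by_cases hA : ∀ v ∉ S, weight p (comp G S v) ≤ weight w O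
  · have hlt : weight w S < weight w O := by
      by_contra hle
      exact hfail fun v hv => (hA v hv).trans (not_lt.1 hle)
    -- A penalized vertex outside `S` would give its component a p-weight of at least B > w(O).
    have hHS : H ⊆ S := by
      intro v hv
      by_contra hvS
      have h1 : p v ≤ weight p (comp G S v) := le_weight self_mem_comp
      have := hA v hvS
      rw [hpH v hv] at h1
      omega
    have hOS : ¬ O ⊆ S := fun h => absurd (weight_mono (w := w) h) (not_le.2 hlt)
    obtain ⟨v, hvO, hvS, hv⟩ := exists_adj_of_not_subset hO'.1 hrO hrS hOS
    have hvH : v ∉ H := fun h => hvS (hHS h)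
    obtain ⟨hwv, hkr⟩ := (hgood v hvO).resolve_left hvH
    refine ⟨⟨v, hvS, hv, ?_⟩, ?_⟩
    · rw [hpw v hvH]; omega
    -- All penalized vertices are in `S`, so eligibility of `b` now means w(b) ≤ w(r); maximality
    -- plays no role in this phase.
    · rintro b ⟨hbS, -, hb⟩ -
      rw [hpw b fun h => hbS (hHS h)] at hb
      refine ⟨Set.mem_insert_of_mem _ hrS, ?_, Or.inr fun x hx => ?_⟩
      · calc k * weight w (insert b S) ≤ k * (weight w O + w r) :=
              Nat.mul_le_mul_left _ ((weight_insert_le b).trans (by omega))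
          _ ≤ (k + 1) * weight w O := by rw [mul_add, add_mul]; omega
      · exact (weight_mono (comp_anti (Set.subset_insert _ _))).trans
          (hA x fun h => hx (Set.mem_insert_of_mem _ h))
  · have hSO : S ⊆ O := hcase.resolve_right hA
    have key : ∀ v, v ∉ S → (∃ u ∈ S, G.Adj u v) → weight w O < weight p (comp G S v) →
        v ∈ O := by
      rintro v hvS ⟨u, huS, huv⟩ hlt
      by_contra hvO
      have hd := disjoint_comp hT.isAcyclic hO'.1 (hSO huS) huS hvO huv
      have h1 : weight p (comp G S v) ≤ weight w (comp G S v) :=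
        weight_mono_fun fun x hx => (hpw x fun h => Set.disjoint_left.1 hd hx (hH h)).le
      have h2 := weight_mono (w := w) (comp_subset_comp hd)
      have h3 := hO'.2 v hvO
      omega
    have hel : ∀ v ∈ O, w v + w v ≤ w r + p v := by
      intro v hv
      by_cases h : v ∈ H
      · have : w v ≤ weight w O := le_weight hv
        rw [hpH v h]; omega
      · have := (hgood v hv).resolve_left h
        rw [hpw v h]; omega
    push Not at hA
    -- The heavy component of `x` contains a neighbor `v` of `S`. It is eligible, so the component
    -- of the greedy choice `b` is at least as heavy, which forces `b` into `O`.
    obtain ⟨x, hxS, hx⟩ := hA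
    obtain ⟨v, hv, hvS, hva⟩ := exists_adj_of_notMem hT.connected ⟨r, hrS⟩ hxS
    have hvlt : weight w O < weight p (comp G S v) :=
      hx.trans_le (weight_mono (comp_subset_of_mem hv))
    have hvE : Eligible G w p (w r) S v := ⟨hvS, hva, hel v (key v hvS hva hvlt)⟩
    refine ⟨⟨v, hvE⟩, fun b hb hmax => ?_⟩
    have hbO : insert b S ⊆ O :=
      Set.insert_subset (key b hb.1 hb.2.1 (hvlt.trans_le (hmax v hvE))) hSO
    refine ⟨Set.mem_insert_of_mem _ hrS, ?_, Or.inl hbO⟩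
    exact Nat.mul_le_mul (Nat.le_succ k) (weight_mono hbO)

theorem greedyInv_singleton {w p : V → ℕ} {k : ℕ} {O : Set V} {r : V} (hr : r ∈ O) :
    GreedyInv G w p k O r {r} :=
  have h := Set.singleton_subset_iff.2 hr
  ⟨rfl, Nat.mul_le_mul (Nat.le_succ k) (weight_mono h), Or.inl h⟩

/-- A set `O` has fewer than `k` vertices of more than `1/k` of its weight, and the other vertices
of `O` are at most as heavy as some vertex `r` of `O`. -/
theorem exists_heavy (w : V → ℕ) {k : ℕ} (hk : 0 < k) {O : Set V} (hO : O.Nonempty) :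
    ∃ (r : V) (h : ℕ → V), r ∈ O ∧ (∀ i, h i ∈ O) ∧
      ∀ v ∈ O, (∃ i < k, h i = v) ∨ (w v ≤ w r ∧ k * w r ≤ weight w O) := by
  classical
  set H : Finset V := Finset.univ.filter fun v => v ∈ O ∧ weight w O < k * w v with hHdef
  have hHmem : ∀ v, v ∈ H ↔ v ∈ O ∧ weight w O < k * w v := by simp [hHdef]
  have hcard : H.card ≤ k := by
    by_contra hlt
    have h1 : ∑ v ∈ H, k * w v ≤ k * weight w O := by
      rw [← Finset.mul_sum]
      refine Nat.mul_le_mul_left _ ?_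
      unfold weight
      refine Finset.sum_le_sum_of_subset fun v hv => ?_
      simpa using ((hHmem v).1 hv).1
    -- The strict inequality defining `H`, read as a lower bound by w(O) + 1, keeps the count valid
    -- when w(O) = 0.
    have h2 : H.card • (weight w O + 1) ≤ ∑ v ∈ H, k * w v :=
      Finset.card_nsmul_le_sum _ _ _ fun v hv => ((hHmem v).1 hv).2
    rw [smul_eq_mul] at h2
    nlinarith
  obtain ⟨r, hrO, hr⟩ : ∃ r ∈ O, ∀ v ∈ O, v ∉ H → w v ≤ w r ∧ k * w r ≤ weight w O := by
    by_cases hne : (Finset.univ.filter fun v => v ∈ O ∧ v ∉ H).Nonempty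
    · obtain ⟨r, hr, hmax⟩ := Finset.exists_max_image _ w hne
      simp only [Finset.mem_filter, Finset.mem_univ, true_and] at hr hmax
      refine ⟨r, hr.1, fun v hv hvH => ⟨hmax v ⟨hv, hvH⟩, ?_⟩⟩
      have := hr.2
      rw [hHmem] at this
      exact not_lt.1 fun h => this ⟨hr.1, h⟩
    -- Without light vertices any `r` in `O` will do.
    · obtain ⟨r, hr⟩ := hO
      refine ⟨r, hr, fun v hv hvH => absurd ⟨v, ?_⟩ hne⟩
      simp only [Finset.mem_filter, Finset.mem_univ, true_and]
      exact ⟨hv, hvH⟩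
  -- Unused positions of the tuple repeat `r`. Penalizing `r` as well is harmless, since all that is
  -- needed is that the penalized vertices lie in `O`.
  refine ⟨r, fun i => H.toList.getD i r, hrO, fun i => ?_, fun v hv => ?_⟩
  · rcases lt_or_ge i H.toList.length with hi | hi
    · simp only [List.getD_eq_getElem _ _ hi]
      exact ((hHmem _).1 (Finset.mem_toList.1 (List.getElem_mem hi))).1
    · simpa only [List.getD_eq_default _ _ hi] using hrO
  · by_cases hvH : v ∈ H
    · left
      obtain ⟨i, hi, hiv⟩ := List.mem_iff_getElem.1 (Finset.mem_toList.2 hvH)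
      refine ⟨i, ?_, ?_⟩
      · rw [Finset.length_toList] at hi; omega
      · simp only [List.getD_eq_getElem _ _ hi, hiv]
    · exact Or.inr (hr v hv hvH)

theorem mem_ball_card (h : G.Reachable v x) : x ∈ ball G v (Fintype.card V) := by
  obtain ⟨q, hq⟩ := h.symm.exists_isPath
  exact ball_mono G v hq.length_lt.le (mem_ball_length q)

theorem isConnectedSafe_univ (hG : G.Connected) (w : V → ℕ) : IsConnectedSafe G w Set.univ :=
  (isConnectedSafe_iff hG).2
    ⟨(SimpleGraph.induceUnivIso G).connected_iff.2 hG, fun v hv => absurd (Set.mem_univ v) hv⟩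

theorem exists_isConnectedSafe_weight_eq_cs (hG : G.Connected) (w : V → ℕ) :
    ∃ S, IsConnectedSafe G w S ∧ weight w S = cs G w :=
  Nat.sInf_mem (s := {m | ∃ S : Set V, IsConnectedSafe G w S ∧ weight w S = m})
    ⟨_, Set.univ, isConnectedSafe_univ hG w, rfl⟩

end Greedy

end SafeSet

namespace Ram

/-! Programs whose loops all run over `0, …, n - 1`, where `n` is the content of cell `0` of array
`0`. They always halt, so that they have a semantics by total functions. -/

/-- Loop programs; `loop x p` runs `p` with cell `0` of array `x` counting from `0` to `n - 1`. -/
inductive Cmd : Type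
  | skip
  | write (a : ℕ) (index e : Expr)
  | seq (p q : Cmd)
  | ifLt (e₁ e₂ : Expr) (p q : Cmd)
  | loop (x : ℕ) (p : Cmd)

/-- The content of cell `0` of array `x`. -/
abbrev Expr.var (x : ℕ) : Expr := .read x (.const 0)

namespace Cmd

/-- The translation into programs. -/
def compile : Cmd → Program
  | skip => .skip
  | write a i e => .write a i e
  | seq p q => .seq p.compile q.compile
  | ifLt e₁ e₂ p q => .ifLt e₁ e₂ p.compile q.compile
  | loop x p => .seq (.write x (.const 0) (.const 0))
      (.whileLt (.var x) (.var 0)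
        (.seq p.compile (.write x (.const 0) (.add (.var x) (.const 1)))))

/-- Applying `f` to a memory `i` times, with a counter in cell `0` of array `x`. -/
def iter (f : Memory → Memory) (x : ℕ) (σ : Memory) : ℕ → Memory
  | 0 => σ.set x 0 0
  | i + 1 => (f (iter f x σ i)).set x 0 (i + 1)

/-- The final memory of a loop program. -/
def run (n : ℕ) : Cmd → Memory → Memory
  | skip, σ => σ
  | write a i e, σ => σ.set a (i.eval σ) (e.eval σ)
  | seq p q, σ => q.run n (p.run n σ)
  | ifLt e₁ e₂ p q, σ => if e₁.eval σ < e₂.eval σ then p.run n σ else q.run n σ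
  | loop x p, σ => iter (p.run n) x σ n

/-- Whether a loop program may write into the array `a`. -/
def writes : Cmd → ℕ → Bool
  | skip, _ => false
  | write b _ _, a => a == b
  | seq p q, a => p.writes a || q.writes a
  | ifLt _ _ p q, a => p.writes a || q.writes a
  | loop x p, a => a == x || p.writes a

/-- Loop programs that do not write into their active loop counters. -/
def ok : Cmd → Bool
  | skip => true
  | write _ _ _ => true
  | seq p q => p.ok && q.ok
  | ifLt _ _ p q => p.ok && q.ok
  | loop x p => !p.writes x && p.ok

/-- A bound for the number of steps. -/
def time (n : ℕ) : Cmd → ℕ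
  | skip => 1
  | write _ i e => i.cost + e.cost + 1
  | seq p q => p.time n + q.time n
  | ifLt e₁ e₂ p q => e₁.cost + e₂.cost + 1 + (p.time n + q.time n)
  | loop _ p => 8 + n * (p.time n + 11)

/-- The coefficient of a polynomial bound for the number of steps. -/
def size : Cmd → ℕ
  | skip => 1
  | write _ i e => i.cost + e.cost + 1
  | seq p q => p.size + q.size
  | ifLt e₁ e₂ p q => e₁.cost + e₂.cost + 1 + (p.size + q.size)
  | loop _ p => p.size + 19

/-- The nesting depth of the loops. -/
def depth : Cmd → ℕ
  | skip => 0
  | write _ _ _ => 0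
  | seq p q => max p.depth q.depth
  | ifLt _ _ p q => max p.depth q.depth
  | loop _ p => p.depth + 1

theorem time_le {n : ℕ} (hn : 1 ≤ n) (c : Cmd) : c.time n ≤ c.size * n ^ c.depth := by
  have hp : ∀ d, 1 ≤ n ^ d := fun d => Nat.one_le_pow _ _ hn
  have hm : ∀ (s : ℕ) {d e : ℕ}, d ≤ e → s * n ^ d ≤ s * n ^ e := fun s d e h =>
    Nat.mul_le_mul_left _ (Nat.pow_le_pow_right hn h)
  induction c with
  | skip => simp [time, size, depth]
  | write a i e => simp [time, size, depth]
  | seq p q ihp ihq =>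
    simp only [time, size, depth, add_mul]
    exact add_le_add (ihp.trans (hm _ (le_max_left _ _))) (ihq.trans (hm _ (le_max_right _ _)))
  | ifLt e₁ e₂ p q ihp ihq =>
    simp only [time, size, depth]
    rw [add_mul _ (p.size + q.size), add_mul p.size]
    exact add_le_add (Nat.le_mul_of_pos_right _ (hp _))
      (add_le_add (ihp.trans (hm _ (le_max_left _ _))) (ihq.trans (hm _ (le_max_right _ _))))
  | loop x p ih =>
    -- The 19 in `size` is 8 + 11, the overhead of a loop and of one iteration, each at most a
    -- multiple of n^(d+1).
    simp only [time, size, depth, pow_succ]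
    have h1 : n * p.time n ≤ n * (p.size * n ^ p.depth) := Nat.mul_le_mul_left _ ih
    have h2 : n ≤ n ^ p.depth * n := Nat.le_mul_of_pos_left _ (hp _)
    nlinarith

end Cmd

theorem Memory.set_of_ne (σ : Memory) {a b : ℕ} (i v : ℕ) (h : b ≠ a) : σ.set a i v b = σ b := by
  funext j
  simp [Memory.set, h]

theorem Memory.set_self (σ : Memory) (a i v j : ℕ) :
    σ.set a i v a j = if j = i then v else σ a j := by
  simp [Memory.set]

namespace Cmd

/-- The frame rule. As `writes` is computable, its hypothesis is mostly settled by `rfl` below. -/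
theorem run_of_not_writes {n a : ℕ} (c : Cmd) (h : c.writes a = false) (σ : Memory) :
    c.run n σ a = σ a := by
  induction c generalizing σ with
  | skip => rfl
  | write b i e =>
    simp only [writes, beq_eq_false_iff_ne] at h
    exact Memory.set_of_ne _ _ _ h
  | seq p q ihp ihq =>
    simp only [writes, Bool.or_eq_false_iff] at h
    exact (ihq h.2 _).trans (ihp h.1 _)
  | ifLt e₁ e₂ p q ihp ihq =>
    simp only [writes, Bool.or_eq_false_iff] at h
    simp only [run]
    split
    · exact ihp h.1 _
    · exact ihq h.2 _
  | loop x p ih =>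
    simp only [writes, Bool.or_eq_false_iff, beq_eq_false_iff_ne] at h
    have : ∀ i, iter (p.run n) x σ i a = σ a := by
      intro i
      induction i with
      | zero => exact Memory.set_of_ne _ _ _ h.1
      | succ i hi => exact (Memory.set_of_ne _ _ _ h.1).trans ((ih h.2 _).trans hi)
    exact this n

theorem iter_counter (f : Memory → Memory) (x : ℕ) (σ : Memory) (i : ℕ) :
    iter f x σ i x 0 = i := by
  cases i <;> simp [iter, Memory.set]

/-- The invariant rule for loops. -/
theorem run_loop {n x : ℕ} {p : Cmd} {σ : Memory} (I : ℕ → Memory → Prop)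
    (h0 : I 0 (σ.set x 0 0))
    (hs : ∀ i < n, ∀ τ : Memory, τ x 0 = i →
      (∀ a, (loop x p).writes a = false → τ a = σ a) → I i τ →
      I (i + 1) ((p.run n τ).set x 0 (i + 1))) :
    I n ((loop x p).run n σ) := by
  have hframe : ∀ i a, (loop x p).writes a = false → iter (p.run n) x σ i a = σ a := by
    intro i a h
    simp only [writes, Bool.or_eq_false_iff, beq_eq_false_iff_ne] at h
    induction i with
    | zero => exact Memory.set_of_ne _ _ _ h.1
    | succ i hi =>
      exact (Memory.set_of_ne _ _ _ h.1).trans ((run_of_not_writes p h.2 _).trans hi)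
  have : ∀ i ≤ n, I i (iter (p.run n) x σ i) := by
    intro i
    induction i with
    | zero => exact fun _ => h0
    | succ i ih =>
      exact fun hi => hs i hi _ (iter_counter _ _ _ _) (hframe i) (ih (by omega))
  exact this n le_rfl

/-- Array `0` must stay untouched because the compiled loops reread their bound n from it; `ok`
guarantees that the final increment of a round sees the counter unchanged. -/
theorem exec_compile {n : ℕ} (c : Cmd) (hc : c.ok = true) (h0 : c.writes 0 = false)
    (σ : Memory) (hσ : σ 0 0 = n) :
    ∃ t ≤ c.time n, Exec c.compile σ (c.run n σ) t := by
  induction c generalizing σ with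
  | skip => exact ⟨1, le_rfl, .skip σ⟩
  | write a i e => exact ⟨_, le_rfl, .write σ a i e⟩
  | seq p q ihp ihq =>
    simp only [ok, Bool.and_eq_true] at hc
    simp only [writes, Bool.or_eq_false_iff] at h0
    obtain ⟨s, hs, hps⟩ := ihp hc.1 h0.1 σ hσ
    obtain ⟨t, ht, hqt⟩ := ihq hc.2 h0.2 (p.run n σ) (by rw [run_of_not_writes p h0.1, hσ])
    exact ⟨s + t, add_le_add hs ht, .seq _ _ _ _ _ _ _ hps hqt⟩
  | ifLt e₁ e₂ p q ihp ihq =>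
    simp only [ok, Bool.and_eq_true] at hc
    simp only [writes, Bool.or_eq_false_iff] at h0
    simp only [run, compile, time]
    split
    · next h =>
      obtain ⟨s, hs, hps⟩ := ihp hc.1 h0.1 σ hσ
      exact ⟨_, by omega, .ifTrue _ _ _ _ _ _ _ h hps⟩
    · next h =>
      obtain ⟨s, hs, hps⟩ := ihq hc.2 h0.2 σ hσ
      exact ⟨_, by omega, .ifFalse _ _ _ _ _ _ _ h hps⟩
  | loop x p ih =>
    simp only [ok, Bool.and_eq_true, Bool.not_eq_true'] at hc
    have h0' := h0
    simp only [writes, Bool.or_eq_false_iff, beq_eq_false_iff_ne] at h0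
    have hn : ∀ i, iter (p.run n) x σ i 0 0 = n := by
      intro i
      induction i with
      | zero => rw [iter, Memory.set_of_ne _ _ _ h0.1, hσ]
      | succ i hi => rw [iter, Memory.set_of_ne _ _ _ h0.1, run_of_not_writes p h0.2, hi]
    have hw : ∀ j i, i + j = n → ∃ t ≤ 5 + j * (p.time n + 11),
        Exec (.whileLt (.var x) (.var 0)
          (.seq p.compile (.write x (.const 0) (.add (.var x) (.const 1)))))
          (iter (p.run n) x σ i) (iter (p.run n) x σ n) t := by
      intro j
      induction j with
      | zero =>
        intro i hi
        obtain rfl : i = n := hi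
        refine ⟨_, ?_, .whileFalse _ _ _ _ ?_⟩
        · simp [Expr.cost]
        · simp [Expr.eval, iter_counter, hn]
      | succ j ihj =>
        intro i hi
        obtain ⟨s, hs, hps⟩ := ih hc.2 h0.2 (iter (p.run n) x σ i) (hn i)
        obtain ⟨t, ht, hwt⟩ := ihj (i + 1) (by omega)
        have hstep := Exec.write (p.run n (iter (p.run n) x σ i)) x (.const 0)
          (.add (.var x) (.const 1))
        simp only [Expr.eval, run_of_not_writes p hc.1, iter_counter] at hstep
        -- A successful test costs 5 steps and the increment 6, which makes the 11 in `time`; the 8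
        -- is the initial write (3) and the failing test (5).
        refine ⟨_, ?_, .whileTrue _ _ _ _ _ _ _ _ ?_ (.seq _ _ _ _ _ _ _ hps hstep) hwt⟩
        · simp only [Expr.cost, add_mul]
          omega
        · simp only [Expr.eval, iter_counter, hn]
          omega
    obtain ⟨t, ht, hwt⟩ := hw n 0 (by omega)
    have hstart := Exec.write σ x (.const 0) (.const 0)
    refine ⟨_, ?_, .seq _ _ _ _ _ _ _ hstart hwt⟩
    simp only [Expr.cost, time]
    omega

end Cmd

end Ram

/-! ### Memory layout, filling and summing arrays. -/

namespace Ram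

open SafeSet

local notation "arrWt" => (1 : ℕ)
local notation "arrAdj" => (2 : ℕ)
local notation "arrOut" => (3 : ℕ)
local notation "arrMul" => (4 : ℕ)
local notation "arrSet" => (5 : ℕ)
local notation "arrMark" => (6 : ℕ)
local notation "arrPen" => (7 : ℕ)
local notation "varBest" => (8 : ℕ)
local notation "varBig" => (9 : ℕ)
local notation "varStep" => (10 : ℕ)
local notation "varVert" => (11 : ℕ)
local notation "varRound" => (12 : ℕ)
local notation "varFrom" => (13 : ℕ)
local notation "varTo" => (14 : ℕ)
local notation "varSum" => (15 : ℕ)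
local notation "varIdx" => (16 : ℕ)
local notation "varSetWt" => (17 : ℕ)
local notation "varMax" => (18 : ℕ)
local notation "varArg" => (19 : ℕ)
local notation "varKey" => (20 : ℕ)
local notation "varComp" => (21 : ℕ)
local notation "varNbr" => (22 : ℕ)
local notation "varRoot" => (23 : ℕ)
local notation "varTuple" => (24 : ℕ)

/-- The content of the cell of array `a` whose index is in cell `0` of array `x`. -/
abbrev Expr.cell (a x : ℕ) : Expr := .read a (.var x)

/-- The set of vertices whose characteristic vector is in array `a`. -/
def marked (n a : ℕ) (σ : Memory) : Set (Fin n) := {v | σ a v ≠ 0}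

/-- The vertex weights in array `a`. -/
def vals (n a : ℕ) (σ : Memory) : Fin n → ℕ := fun v => σ a v

section Marked

variable {n a b : ℕ} {σ τ : Memory}

theorem marked_congr (h : τ a = σ a) : marked n a τ = marked n a σ := by
  simp only [marked, h]

theorem vals_congr (h : τ a = σ a) : vals n a τ = vals n a σ := by
  funext v
  simp only [vals, h]

theorem marked_set_of_ne (i v : ℕ) (h : b ≠ a) : marked n b (σ.set a i v) = marked n b σ :=
  marked_congr (Memory.set_of_ne _ _ _ h)

theorem vals_set_of_ne (i v : ℕ) (h : b ≠ a) : vals n b (σ.set a i v) = vals n b σ :=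
  vals_congr (Memory.set_of_ne _ _ _ h)

theorem marked_set_one (u : Fin n) : marked n a (σ.set a u 1) = insert u (marked n a σ) := by
  ext v
  by_cases h : v = u
  · simp [marked, Memory.set_self, h]
  · have : (v : ℕ) ≠ u := fun h' => h (Fin.ext h')
    simp [marked, Memory.set_self, h, this]

end Marked

namespace Cmd

theorem run_ifLt_apply (n : ℕ) (e₁ e₂ : Expr) (p q : Cmd) (σ : Memory) (a i : ℕ) :
    (ifLt e₁ e₂ p q).run n σ a i =
      if e₁.eval σ < e₂.eval σ then p.run n σ a i else q.run n σ a i := by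
  simp only [run]
  split <;> rfl

/-- Set all cells of array `a` with index less than `n`. -/
def fill (a : ℕ) (e : Expr) : Cmd := .loop varIdx (.write a (.var varIdx) e)

theorem run_fill {n a : ℕ} {e : Expr} {σ : Memory} (f : ℕ → ℕ) (ha : a ≠ varIdx)
    (he : ∀ i < n, ∀ τ : Memory, τ varIdx 0 = i → (∀ b, b ≠ a → b ≠ varIdx → τ b = σ b) →
      e.eval τ = f i) (i : ℕ) (hi : i < n) : (fill a e).run n σ a i = f i := by
  refine run_loop (n := n) (fun j τ => ∀ i < j, τ a i = f i) (by simp) ?_ i hi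
  intro j hj τ hτ hframe hI i hi
  rw [Memory.set_of_ne _ _ _ ha]
  simp only [run, Expr.eval, hτ, Memory.set_self]
  split
  · next h =>
    subst h
    exact he _ hj τ hτ fun b hb hb' => hframe b (by simp [writes, hb, hb'])
  · exact hI i (by omega)

/-- Add up the values in array `val` of the vertices marked in array `mask`. -/
def sumMask (acc mask val : ℕ) : Cmd :=
  .seq (.write acc (.const 0) (.const 0))
    (.loop varSum (.ifLt (.const 0) (.cell mask varSum)
      (.write acc (.const 0) (.add (.var acc) (.cell val varSum))) .skip))

theorem run_sumMask {n acc mask val : ℕ} (σ : Memory) (h1 : acc ≠ varSum) (h2 : mask ≠ acc)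
    (h3 : val ≠ acc) (h4 : mask ≠ varSum) (h5 : val ≠ varSum) :
    (sumMask acc mask val).run n σ acc 0 = weight (vals n val σ) (marked n mask σ) := by
  have key : (sumMask acc mask val).run n σ acc 0
      = ∑ j ∈ Finset.range n, if σ mask j ≠ 0 then σ val j else 0 := by
    refine run_loop (n := n) (fun i τ => τ acc 0
      = ∑ j ∈ Finset.range i, if σ mask j ≠ 0 then σ val j else 0) ?_ ?_
    · simp [Memory.set_of_ne _ _ _ h1, run, Memory.set_self, Expr.eval]
    · intro i _ τ hτ hframe hI
      have hm : τ mask = σ mask := by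
        rw [hframe mask (by simp [writes, h2, h4]), run, Memory.set_of_ne _ _ _ h2]
      have hv : τ val = σ val := by
        rw [hframe val (by simp [writes, h3, h5]), run, Memory.set_of_ne _ _ _ h3]
      rw [Memory.set_of_ne _ _ _ h1, Finset.sum_range_succ, ← hI]
      simp only [run_ifLt_apply]
      simp only [run, Expr.eval, hτ, hm, hv]
      by_cases h : σ mask i = 0
      · simp [h]
      · simp [h, Nat.pos_of_ne_zero h, Memory.set_self]
  rw [key, weight_eq_sum_ite, ← Fin.sum_univ_eq_sum_range]
  refine Finset.sum_congr rfl fun v _ => ?_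
  simp only [marked, vals, Set.mem_ofPred_eq]
  congr

end Cmd

/-- The memory contains the graph `T` and the weights `w`. -/
structure Holds {n : ℕ} (T : SimpleGraph (Fin n)) (w : Fin n → ℕ) (σ : Memory) : Prop where
  wt : ∀ v : Fin n, σ arrWt v = w v
  adj : ∀ u v : Fin n, σ arrAdj (σ arrMul u + v) ≠ 0 ↔ T.Adj u v

/-! ### Computing components and neighbors by loop programs. -/

section Specs

variable {n : ℕ} {T : SimpleGraph (Fin n)} {w : Fin n → ℕ} {σ τ : Memory}

theorem Holds.congr (h : Holds T w σ) (h1 : τ arrWt = σ arrWt) (h2 : τ arrAdj = σ arrAdj)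
    (h4 : τ arrMul = σ arrMul) : Holds T w τ :=
  ⟨fun v => by rw [h1, h.wt], fun u v => by rw [h2, h4, h.adj]⟩

theorem Holds.vals_eq (h : Holds T w σ) : vals n arrWt σ = w := funext h.wt

namespace Cmd

/-- Mark the current endpoint `varTo` if the current edge leaves the marked set and does not enter
the set in `arrSet`. -/
def relax : Cmd :=
  .ifLt (.const 0) (.cell arrMark varFrom)
    (.ifLt (.const 0) (.read arrAdj (.add (.cell arrMul varFrom) (.var varTo)))
      (.ifLt (.cell arrSet varTo) (.const 1)
        (.write arrMark (.var varTo) (.const 1)) .skip) .skip) .skip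

open Classical in
theorem run_relax (hσ : Holds T w σ) (a b : Fin n) (ha : σ varFrom 0 = a) (hb : σ varTo 0 = b) :
    marked n arrMark (relax.run n σ) =
      if a ∈ marked n arrMark σ ∧ T.Adj a b ∧ b ∉ marked n arrSet σ
      then insert b (marked n arrMark σ) else marked n arrMark σ := by
  simp only [relax, run, Expr.eval, ha, hb, Nat.lt_one_iff, Nat.pos_iff_ne_zero, hσ.adj]
  by_cases h1 : σ arrMark a = 0
  · simp [h1, marked]
  by_cases h2 : T.Adj a b
  swap
  · simp [h2]
  by_cases h3 : σ arrSet b = 0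
  · rw [if_pos h1, if_pos h2, if_pos h3, if_pos ⟨h1, h2, fun h => h h3⟩, marked_set_one]
  · rw [if_pos h1, if_pos h2, if_neg h3, if_neg fun h => h.2.2 h3]

theorem run_loop_to (hσ : Holds T w σ) (a v : Fin n) (ha : σ varFrom 0 = a)
    (hv : v ∉ marked n arrSet σ)
    (hM : marked n arrMark σ ⊆ comp T (marked n arrSet σ) v) :
    marked n arrMark σ ⊆ marked n arrMark ((loop varTo relax).run n σ) ∧
      marked n arrMark ((loop varTo relax).run n σ) ⊆ comp T (marked n arrSet σ) v ∧
      (a ∈ marked n arrMark σ → ∀ b, (outside T (marked n arrSet σ)).Adj a b →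
        b ∈ marked n arrMark ((loop varTo relax).run n σ)) := by
  have := run_loop (n := n) (x := varTo) (p := relax) (σ := σ) (fun j τ =>
    marked n arrMark σ ⊆ marked n arrMark τ ∧
      marked n arrMark τ ⊆ comp T (marked n arrSet σ) v ∧
      (a ∈ marked n arrMark σ → ∀ b : Fin n, (b : ℕ) < j →
        (outside T (marked n arrSet σ)).Adj a b → b ∈ marked n arrMark τ)) ?_ ?_
  · exact ⟨this.1, this.2.1, fun h b => this.2.2 h b b.2⟩
  · rw [marked_set_of_ne _ _ (by decide)]
    exact ⟨subset_rfl, hM, fun _ b hb => absurd hb (Nat.not_lt_zero _)⟩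
  · rintro j hj τ hτ hframe ⟨h1, h2, h3⟩
    have hS : marked n arrSet τ = marked n arrSet σ := marked_congr (hframe _ rfl)
    rw [marked_set_of_ne _ _ (by decide),
      run_relax (hσ.congr (hframe _ rfl) (hframe _ rfl) (hframe _ rfl)) a ⟨j, hj⟩
        (by rw [hframe _ rfl, ha]) hτ, hS]
    split
    · next h =>
      have haj : (outside T (marked n arrSet σ)).Adj a ⟨j, hj⟩ :=
        ⟨h.2.1, notMem_of_mem_comp hv (h2 h.1), h.2.2⟩
      refine ⟨h1.trans (Set.subset_insert _ _), Set.insert_subset ?_ h2, fun ha' b hb hab => ?_⟩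
      · exact SimpleGraph.Reachable.trans (h2 h.1) haj.reachable
      · rcases Nat.lt_succ_iff_lt_or_eq.1 hb with hb | hb
        · exact Or.inr (h3 ha' b hb hab)
        · exact Or.inl (Fin.ext hb)
    · next h =>
      refine ⟨h1, h2, fun ha' b hb hab => ?_⟩
      rcases Nat.lt_succ_iff_lt_or_eq.1 hb with hb | hb
      · exact h3 ha' b hb hab
      · obtain rfl : b = ⟨j, hj⟩ := Fin.ext hb
        exact absurd ⟨h1 ha', hab.1, hab.2.2⟩ h

theorem run_loop_from (hσ : Holds T w σ) (v : Fin n) (hv : v ∉ marked n arrSet σ)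
    (hM : marked n arrMark σ ⊆ comp T (marked n arrSet σ) v) :
    marked n arrMark σ ⊆ marked n arrMark ((loop varFrom (loop varTo relax)).run n σ) ∧
      marked n arrMark ((loop varFrom (loop varTo relax)).run n σ)
        ⊆ comp T (marked n arrSet σ) v ∧
      ∀ a ∈ marked n arrMark σ, ∀ b, (outside T (marked n arrSet σ)).Adj a b →
        b ∈ marked n arrMark ((loop varFrom (loop varTo relax)).run n σ) := by
  have := run_loop (n := n) (x := varFrom) (p := loop varTo relax) (σ := σ) (fun j τ =>
    marked n arrMark σ ⊆ marked n arrMark τ ∧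
      marked n arrMark τ ⊆ comp T (marked n arrSet σ) v ∧
      ∀ a ∈ marked n arrMark σ, (a : ℕ) < j → ∀ b : Fin n,
        (outside T (marked n arrSet σ)).Adj a b → b ∈ marked n arrMark τ) ?_ ?_
  · exact ⟨this.1, this.2.1, fun a ha => this.2.2 a ha a.2⟩
  · rw [marked_set_of_ne _ _ (by decide)]
    exact ⟨subset_rfl, hM, fun a _ ha => absurd ha (Nat.not_lt_zero _)⟩
  · rintro j hj τ hτ hframe ⟨h1, h2, h3⟩
    have hS : marked n arrSet τ = marked n arrSet σ := marked_congr (hframe _ rfl)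
    obtain ⟨g1, g2, g3⟩ := run_loop_to
      (hσ.congr (hframe _ rfl) (hframe _ rfl) (hframe _ rfl)) ⟨j, hj⟩ v hτ (hS ▸ hv) (hS ▸ h2)
    rw [hS] at g2 g3
    rw [marked_set_of_ne _ _ (by decide)]
    refine ⟨h1.trans g1, g2, fun a ha haj b hab => ?_⟩
    rcases Nat.lt_succ_iff_lt_or_eq.1 haj with haj | haj
    · exact g1 (h3 a ha haj b hab)
    · obtain rfl : a = ⟨j, hj⟩ := Fin.ext haj
      exact g3 (h1 ha) b hab

/-- Mark the component of the current vertex `varVert` in the graph minus the set in `arrSet`. -/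
def reach : Cmd :=
  .seq (fill arrMark (.const 0)) (.seq (.write arrMark (.var varVert) (.const 1))
    (.loop varRound (.loop varFrom (.loop varTo relax))))

/-- Marks are set in place, so a round may reach further than one edge. The marked set is therefore
only squeezed between the ball of radius j and the component; after n rounds both coincide. -/
theorem run_reach (hσ : Holds T w σ) (v : Fin n) (hv : σ varVert 0 = v)
    (hvS : v ∉ marked n arrSet σ) :
    marked n arrMark (reach.run n σ) = comp T (marked n arrSet σ) v := by
  have h0 : marked n arrMark ((fill arrMark (.const 0)).run n σ) = ∅ := by
    ext x
    simp [marked, run_fill (σ := σ) (e := .const 0) (a := arrMark) (fun _ => 0) (by decide)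
      (fun _ _ _ _ _ => rfl) x x.2]
  have hS : ∀ τ : Memory, τ = (fill arrMark (.const 0)).run n σ →
      ∀ a, a ≠ arrMark → a ≠ varIdx → τ a = σ a := by
    rintro _ rfl a h h'
    exact run_of_not_writes _ (by simp [fill, writes, h, h']) _
  change marked n arrMark (run n _ (run n _ (run n _ σ))) = _
  generalize (fill arrMark (.const 0)).run n σ = σ₁ at h0 hS
  specialize hS σ₁ rfl
  have h1 : marked n arrMark ((write arrMark (.var varVert) (.const 1)).run n σ₁) = {v} := by
    simp only [run, Expr.eval, hS varVert (by decide) (by decide), hv, marked_set_one, h0,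
      insert_empty_eq]
  have hS2 : ∀ τ : Memory, τ = (write arrMark (.var varVert) (.const 1)).run n σ₁ →
      ∀ a, a ≠ arrMark → a ≠ varIdx → τ a = σ a := by
    rintro _ rfl a h h'
    rw [run_of_not_writes _ (by simp [writes, h]), hS a h h']
  generalize (write arrMark (.var varVert) (.const 1)).run n σ₁ = σ₂ at h1 hS2
  specialize hS2 σ₂ rfl
  have hsub : marked n arrSet σ₂ = marked n arrSet σ :=
    marked_congr (hS2 _ (by decide) (by decide))
  have := run_loop (n := n) (x := varRound) (p := loop varFrom (loop varTo relax)) (σ := σ₂)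
    (fun j τ => ball (outside T (marked n arrSet σ)) v j ⊆ marked n arrMark τ ∧
      marked n arrMark τ ⊆ comp T (marked n arrSet σ) v) ?_ ?_
  · refine subset_antisymm this.2 fun x hx => this.1 ?_
    have := mem_ball_card hx
    rwa [Fintype.card_fin] at this
  · rw [marked_set_of_ne _ _ (by decide), h1]
    exact ⟨subset_rfl, Set.singleton_subset_iff.2 self_mem_comp⟩
  · rintro j hj τ hτ hframe ⟨g1, g2⟩
    have hf : ∀ a, a ≠ arrMark → a ≠ varIdx →
        (loop varRound (loop varFrom (loop varTo relax))).writes a = false → τ a = σ a :=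
      fun a h h' h'' => (hframe a h'').trans (hS2 a h h')
    have hS : marked n arrSet τ = marked n arrSet σ :=
      marked_congr (hf _ (by decide) (by decide) rfl)
    obtain ⟨e1, e2, e3⟩ := run_loop_from (hσ.congr (hf _ (by decide) (by decide) rfl)
      (hf _ (by decide) (by decide) rfl) (hf _ (by decide) (by decide) rfl)) v
      (hS ▸ hvS) (hS ▸ g2)
    rw [hS] at e2 e3
    rw [marked_set_of_ne _ _ (by decide)]
    refine ⟨?_, e2⟩
    rintro b (hb | ⟨a, ha, hab⟩)
    · exact e1 (g1 hb)
    · exact e3 a (g1 ha) b hab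

/-- Test whether the current vertex `varVert` has a neighbor in the set in `arrSet`. -/
def nbrTest : Cmd :=
  .seq (.write varNbr (.const 0) (.const 0))
    (.loop varFrom (.ifLt (.const 0) (.cell arrSet varFrom)
      (.ifLt (.const 0) (.read arrAdj (.add (.cell arrMul varFrom) (.var varVert)))
        (.write varNbr (.const 0) (.const 1)) .skip) .skip))

theorem run_nbrTest (hσ : Holds T w σ) (v : Fin n) (hv : σ varVert 0 = v) :
    0 < nbrTest.run n σ varNbr 0 ↔ ∃ u ∈ marked n arrSet σ, T.Adj u v := by
  have := run_loop (n := n) (x := varFrom) (p := .ifLt (.const 0) (.cell arrSet varFrom)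
      (.ifLt (.const 0) (.read arrAdj (.add (.cell arrMul varFrom) (.var varVert)))
        (.write varNbr (.const 0) (.const 1)) .skip) .skip)
      (σ := (write varNbr (.const 0) (.const 0)).run n σ)
      (fun j τ => 0 < τ varNbr 0 ↔ ∃ u ∈ marked n arrSet σ, (u : ℕ) < j ∧ T.Adj u v) ?_ ?_
  · refine this.trans ⟨?_, ?_⟩
    · rintro ⟨u, hu, -, h⟩
      exact ⟨u, hu, h⟩
    · rintro ⟨u, hu, h⟩
      exact ⟨u, hu, u.2, h⟩
  · simp [run, Memory.set, Expr.eval]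
  · intro j hj τ hτ hframe hI
    have hf : ∀ a, a ≠ varNbr → a ≠ varFrom → τ a = σ a := by
      intro a h h'
      rw [hframe a (by simp [writes, h, h']), run_of_not_writes _ (by simp [writes, h])]
    rw [Memory.set_of_ne _ _ _ (by decide)]
    have hadj := hσ.adj ⟨j, hj⟩ v
    simp only at hadj
    have hadj' : (Expr.const 0).eval τ <
        (Expr.read arrAdj (.add (.cell arrMul varFrom) (.var varVert))).eval τ ↔
          T.Adj ⟨j, hj⟩ v := by
      simp only [Expr.eval]
      rw [hf arrAdj (by decide) (by decide), hf arrMul (by decide) (by decide),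
        hf varVert (by decide) (by decide), hτ, hv, Nat.pos_iff_ne_zero, hadj]
    have hset : (Expr.const 0).eval τ < (Expr.cell arrSet varFrom).eval τ ↔ σ arrSet j ≠ 0 := by
      simp only [Expr.eval]
      rw [hf arrSet (by decide) (by decide), hτ, Nat.pos_iff_ne_zero]
    simp only [run_ifLt_apply]
    have hsucc : (∃ u ∈ marked n arrSet σ, (u : ℕ) < j + 1 ∧ T.Adj u v) ↔
        (∃ u ∈ marked n arrSet σ, (u : ℕ) < j ∧ T.Adj u v) ∨
          (σ arrSet j ≠ 0 ∧ T.Adj ⟨j, hj⟩ v) := by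
      constructor
      · rintro ⟨u, hu, huj, huv⟩
        rcases Nat.lt_succ_iff_lt_or_eq.1 huj with huj | huj
        · exact Or.inl ⟨u, hu, huj, huv⟩
        · obtain rfl : u = ⟨j, hj⟩ := Fin.ext huj
          exact Or.inr ⟨hu, huv⟩
      · rintro (⟨u, hu, huj, huv⟩ | ⟨hu, huv⟩)
        · exact ⟨u, hu, by omega, huv⟩
        · exact ⟨⟨j, hj⟩, hu, Nat.lt_succ_self j, huv⟩
    rw [hsucc, ← hI]
    by_cases h1 : σ arrSet j = 0
    · rw [if_neg fun h => hset.1 h h1]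
      simp [h1, run]
    rw [if_pos (hset.2 h1)]
    by_cases h2 : T.Adj ⟨j, hj⟩ v
    · rw [if_pos (hadj'.2 h2)]
      simp [h1, h2, run, Expr.eval, Memory.set_self]
    · rw [if_neg (mt hadj'.1 h2)]
      simp [h2, run]

end Cmd

end Specs

/-- The memory contains the graph `T`, the weights `w`, the current set `S`, the penalized weights
`p`, and the threshold `θ`. -/
structure Ctx {n : ℕ} (T : SimpleGraph (Fin n)) (w : Fin n → ℕ) (S : Set (Fin n)) (p : Fin n → ℕ)
    (θ : ℕ) (σ : Memory) : Prop extends Holds T w σ where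
  set : marked n arrSet σ = S
  pen : vals n arrPen σ = p
  root : σ arrWt (σ varRoot 0) = θ

/-! ### One step of the greedy algorithm. -/

section Step

variable {n : ℕ} {T : SimpleGraph (Fin n)} {w p : Fin n → ℕ} {S : Set (Fin n)} {θ : ℕ}
  {σ τ : Memory}

theorem Ctx.congr (h : Ctx T w S p θ σ) (h1 : τ arrWt = σ arrWt) (h2 : τ arrAdj = σ arrAdj)
    (h4 : τ arrMul = σ arrMul) (h5 : τ arrSet = σ arrSet) (h7 : τ arrPen = σ arrPen)
    (h23 : τ varRoot = σ varRoot) : Ctx T w S p θ τ :=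
  ⟨h.toHolds.congr h1 h2 h4, (marked_congr h5).trans h.set, (vals_congr h7).trans h.pen, by
    rw [h1, h23, h.root]⟩

theorem Ctx.run (h : Ctx T w S p θ σ) (c : Cmd) (h1 : c.writes arrWt = false)
    (h2 : c.writes arrAdj = false) (h4 : c.writes arrMul = false) (h5 : c.writes arrSet = false)
    (h7 : c.writes arrPen = false) (h23 : c.writes varRoot = false) :
    Ctx T w S p θ (c.run n σ) :=
  h.congr (c.run_of_not_writes h1 σ) (c.run_of_not_writes h2 σ) (c.run_of_not_writes h4 σ)
    (c.run_of_not_writes h5 σ) (c.run_of_not_writes h7 σ) (c.run_of_not_writes h23 σ)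

namespace Cmd

/-- Compute the penalized weight of the component of the current vertex. -/
def measure : Cmd := .seq reach (sumMask varComp arrMark arrPen)

theorem run_measure (hσ : Ctx T w S p θ σ) (v : Fin n) (hv : σ varVert 0 = v) (hvS : v ∉ S) :
    measure.run n σ varComp 0 = weight p (comp T S v) := by
  change (sumMask varComp arrMark arrPen).run n (reach.run n σ) varComp 0 = _
  rw [run_sumMask _ (by decide) (by decide) (by decide) (by decide) (by decide),
    run_reach hσ.toHolds v hv (hσ.set.symm ▸ hvS), hσ.set,
    vals_congr (run_of_not_writes reach rfl σ), hσ.pen]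

/-- Update the maximum weight of a component. -/
def updateMax : Cmd :=
  .ifLt (.var varMax) (.var varComp) (.write varMax (.const 0) (.var varComp)) .skip

theorem run_updateMax : updateMax.run n σ varMax 0 = max (σ varMax 0) (σ varComp 0) := by
  simp only [updateMax, run_ifLt_apply]
  simp only [run, Expr.eval, Memory.set_self, if_true]
  split <;> omega

/-- Update the eligible vertex with the heaviest component. -/
def updateKey : Cmd :=
  .ifLt (.const 0) (.var varNbr)
    (.ifLt (.add (.cell arrWt varVert) (.cell arrWt varVert))
      (.add (.add (.cell arrWt varRoot) (.cell arrPen varVert)) (.const 1))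
      (.ifLt (.var varKey) (.add (.var varComp) (.const 1))
        (.seq (.write varKey (.const 0) (.add (.var varComp) (.const 1)))
          (.write varArg (.const 0) (.var varVert))) .skip) .skip) .skip

theorem run_updateKey (hσ : Ctx T w S p θ σ) (v : Fin n) (hv : σ varVert 0 = v) (hvS : v ∉ S)
    (hnbr : 0 < σ varNbr 0 ↔ ∃ u ∈ S, T.Adj u v) :
    (Eligible T w p θ S v ∧ σ varKey 0 ≤ σ varComp 0 →
      updateKey.run n σ varKey 0 = σ varComp 0 + 1 ∧ updateKey.run n σ varArg 0 = v) ∧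
    (¬ (Eligible T w p θ S v ∧ σ varKey 0 ≤ σ varComp 0) →
      updateKey.run n σ varKey 0 = σ varKey 0 ∧ updateKey.run n σ varArg 0 = σ varArg 0) := by
  have h1 : (Expr.const 0).eval σ < (Expr.var varNbr).eval σ ↔ ∃ u ∈ S, T.Adj u v := hnbr
  have h2 : (Expr.add (.cell arrWt varVert) (.cell arrWt varVert)).eval σ <
      (Expr.add (.add (.cell arrWt varRoot) (.cell arrPen varVert)) (.const 1)).eval σ ↔
        w v + w v ≤ θ + p v := by
    have hp : σ arrPen v = p v := congrFun hσ.pen v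
    simp only [Expr.eval, hv, hσ.wt, hσ.root, hp, Nat.lt_succ_iff]
  have h3 : (Expr.var varKey).eval σ < (Expr.add (.var varComp) (.const 1)).eval σ ↔
      σ varKey 0 ≤ σ varComp 0 := by
    simp only [Expr.eval, Nat.lt_succ_iff]
  simp only [updateKey, run_ifLt_apply]
  constructor
  · rintro ⟨⟨-, g1, g2⟩, g3⟩
    simp only [if_pos (h1.2 g1), if_pos (h2.2 g2), if_pos (h3.2 g3)]
    simp [run, Expr.eval, Memory.set, hv]
  · intro h
    by_cases g1 : ∃ u ∈ S, T.Adj u v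
    swap
    · simp [if_neg (mt h1.1 g1), run]
    by_cases g2 : w v + w v ≤ θ + p v
    swap
    · simp only [if_neg (mt h2.1 g2)]
      simp [run]
    have g3 : ¬ σ varKey 0 ≤ σ varComp 0 := fun g3 => h ⟨⟨hvS, g1, g2⟩, g3⟩
    simp only [if_neg (mt h3.1 g3)]
    simp [run]

/-- Examine the current vertex `varVert`. -/
def examine : Cmd :=
  .ifLt (.cell arrSet varVert) (.const 1)
    (.seq measure (.seq updateMax (.seq nbrTest updateKey))) .skip

theorem run_examine_of_mem (hσ : Ctx T w S p θ σ) (v : Fin n) (hv : σ varVert 0 = v)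
    (hvS : v ∈ S) : examine.run n σ = σ := by
  have h : σ arrSet v ≠ 0 := by rwa [← hσ.set] at hvS
  simp [examine, run, Expr.eval, hv, h]

theorem run_examine (hσ : Ctx T w S p θ σ) (v : Fin n) (hv : σ varVert 0 = v) (hvS : v ∉ S) :
    examine.run n σ varMax 0 = max (σ varMax 0) (weight p (comp T S v)) ∧
    (Eligible T w p θ S v ∧ σ varKey 0 ≤ weight p (comp T S v) →
      examine.run n σ varKey 0 = weight p (comp T S v) + 1 ∧ examine.run n σ varArg 0 = v) ∧
    (¬ (Eligible T w p θ S v ∧ σ varKey 0 ≤ weight p (comp T S v)) →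
      examine.run n σ varKey 0 = σ varKey 0 ∧ examine.run n σ varArg 0 = σ varArg 0) := by
  have h : (Expr.cell arrSet varVert).eval σ < (Expr.const 1).eval σ := by
    have : ¬ σ arrSet v ≠ 0 := by rwa [← hσ.set] at hvS
    simpa [Expr.eval, hv] using this
  have hrun : examine.run n σ =
      updateKey.run n (nbrTest.run n (updateMax.run n (measure.run n σ))) := if_pos h
  have c1 := hσ.run measure rfl rfl rfl rfl rfl rfl
  have v1 : measure.run n σ varVert 0 = v := by rw [run_of_not_writes _ rfl, hv]
  have m1 : measure.run n σ varMax 0 = σ varMax 0 := by rw [run_of_not_writes _ rfl]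
  have k1 : measure.run n σ varKey 0 = σ varKey 0 := by rw [run_of_not_writes _ rfl]
  have a1 : measure.run n σ varArg 0 = σ varArg 0 := by rw [run_of_not_writes _ rfl]
  have e1 := run_measure hσ v hv hvS
  rw [hrun]
  generalize measure.run n σ = σ₁ at *
  have c2 := c1.run updateMax rfl rfl rfl rfl rfl rfl
  have v2 : updateMax.run n σ₁ varVert 0 = v := by rw [run_of_not_writes _ rfl, v1]
  have m2 : updateMax.run n σ₁ varMax 0 = max (σ varMax 0) (weight p (comp T S v)) := by
    rw [run_updateMax, m1, e1]
  have k2 : updateMax.run n σ₁ varKey 0 = σ varKey 0 := by rw [run_of_not_writes _ rfl, k1]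
  have a2 : updateMax.run n σ₁ varArg 0 = σ varArg 0 := by rw [run_of_not_writes _ rfl, a1]
  have e2 : updateMax.run n σ₁ varComp 0 = weight p (comp T S v) := by
    rw [run_of_not_writes _ rfl, e1]
  generalize updateMax.run n σ₁ = σ₂ at *
  have c3 := c2.run nbrTest rfl rfl rfl rfl rfl rfl
  have v3 : nbrTest.run n σ₂ varVert 0 = v := by rw [run_of_not_writes _ rfl, v2]
  have m3 : nbrTest.run n σ₂ varMax 0 = max (σ varMax 0) (weight p (comp T S v)) := by
    rw [run_of_not_writes _ rfl, m2]
  have k3 : nbrTest.run n σ₂ varKey 0 = σ varKey 0 := by rw [run_of_not_writes _ rfl, k2]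
  have a3 : nbrTest.run n σ₂ varArg 0 = σ varArg 0 := by rw [run_of_not_writes _ rfl, a2]
  have e3 : nbrTest.run n σ₂ varComp 0 = weight p (comp T S v) := by
    rw [run_of_not_writes _ rfl, e2]
  have b3 := run_nbrTest c2.toHolds v v2
  rw [c2.set] at b3
  generalize nbrTest.run n σ₂ = σ₃ at *
  have := run_updateKey c3 v v3 hvS b3
  rw [e3, k3, a3] at this
  exact ⟨by rw [run_of_not_writes _ rfl, m3], this⟩

/-- Examine all vertices. -/
def scan : Cmd :=
  .seq (.write varMax (.const 0) (.const 0)) (.seq (.write varKey (.const 0) (.const 0))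
    (.loop varVert examine))

/-- `varMax` is the least upper bound of the component weights. `varKey` holds the p-weight of the
best candidate plus one, so that 0 means that no eligible vertex exists, even if weights vanish. -/
theorem run_scan (hσ : Ctx T w S p θ σ) :
    (∀ v ∉ S, weight p (comp T S v) ≤ scan.run n σ varMax 0) ∧
    (∀ B, (∀ v ∉ S, weight p (comp T S v) ≤ B) → scan.run n σ varMax 0 ≤ B) ∧
    (∀ v, Eligible T w p θ S v → weight p (comp T S v) < scan.run n σ varKey 0) ∧
    (0 < scan.run n σ varKey 0 → ∃ b : Fin n, scan.run n σ varArg 0 = b ∧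
      Eligible T w p θ S b ∧ scan.run n σ varKey 0 = weight p (comp T S b) + 1) := by
  have c1 := hσ.run (.seq (.write varMax (.const 0) (.const 0))
    (.write varKey (.const 0) (.const 0))) rfl rfl rfl rfl rfl rfl
  have := run_loop (n := n) (x := varVert) (p := examine) (σ := run n (.seq
    (.write varMax (.const 0) (.const 0)) (.write varKey (.const 0) (.const 0))) σ) (fun j τ =>
    (∀ v : Fin n, (v : ℕ) < j → v ∉ S → weight p (comp T S v) ≤ τ varMax 0) ∧
    (∀ B, (∀ v ∉ S, weight p (comp T S v) ≤ B) → τ varMax 0 ≤ B) ∧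
    (∀ v : Fin n, (v : ℕ) < j → Eligible T w p θ S v → weight p (comp T S v) < τ varKey 0) ∧
    (0 < τ varKey 0 → ∃ b : Fin n, τ varArg 0 = b ∧
      Eligible T w p θ S b ∧ τ varKey 0 = weight p (comp T S b) + 1)) ?_ ?_
  · exact ⟨fun v => this.1 v v.2, this.2.1, fun v => this.2.2.1 v v.2, this.2.2.2⟩
  · simp [run, Expr.eval, Memory.set]
  · rintro j hj τ hτ hframe ⟨h1, h2, h3, h4⟩
    have c2 : Ctx T w S p θ τ := c1.congr (hframe _ rfl) (hframe _ rfl) (hframe _ rfl)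
      (hframe _ rfl) (hframe _ rfl) (hframe _ rfl)
    simp only [Memory.set_of_ne _ _ _ (show varMax ≠ varVert by decide),
      Memory.set_of_ne _ _ _ (show varKey ≠ varVert by decide),
      Memory.set_of_ne _ _ _ (show varArg ≠ varVert by decide)]
    have hlt : ∀ v : Fin n, (v : ℕ) < j + 1 → (v : ℕ) < j ∨ v = ⟨j, hj⟩ := fun v hv =>
      (Nat.lt_succ_iff_lt_or_eq.1 hv).imp_right fun h => Fin.ext h
    by_cases hjS : (⟨j, hj⟩ : Fin n) ∈ S
    · rw [run_examine_of_mem c2 ⟨j, hj⟩ hτ hjS]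
      refine ⟨fun v hv hvS => ?_, h2, fun v hv hvE => ?_, h4⟩
      · exact h1 v ((hlt v hv).resolve_right fun h => hvS (h ▸ hjS)) hvS
      · exact h3 v ((hlt v hv).resolve_right fun h => hvE.1 (h ▸ hjS)) hvE
    · obtain ⟨g1, g2, g3⟩ := run_examine c2 ⟨j, hj⟩ hτ hjS
      rw [g1]
      refine ⟨fun v hv hvS => ?_, fun B hB => max_le (h2 B hB) (hB _ hjS), ?_⟩
      · rcases hlt v hv with hv | rfl
        · exact le_max_of_le_left (h1 v hv hvS)
        · exact le_max_right _ _
      · by_cases hE : Eligible T w p θ S ⟨j, hj⟩ ∧ τ varKey 0 ≤ weight p (comp T S ⟨j, hj⟩)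
        · obtain ⟨e1, e2⟩ := g2 hE
          rw [e1, e2]
          refine ⟨fun v hv hvE => ?_, fun _ => ⟨⟨j, hj⟩, rfl, hE.1, rfl⟩⟩
          rcases hlt v hv with hv | rfl
          · have := h3 v hv hvE
            have := hE.2
            omega
          · exact Nat.lt_succ_self _
        · obtain ⟨e1, e2⟩ := g3 hE
          rw [e1, e2]
          refine ⟨fun v hv hvE => ?_, h4⟩
          rcases hlt v hv with hv | rfl
          · exact h3 v hv hvE
          · exact not_le.1 fun h => hE ⟨hvE, h⟩

/-- Replace the best set found so far by the current set if this is an improvement. -/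
def record : Cmd :=
  .ifLt (.var varSetWt) (.var varMax) .skip
    (.ifLt (.var varSetWt) (.var varBest)
      (.seq (fill arrOut (.cell arrSet varIdx)) (.write varBest (.const 0) (.var varSetWt))) .skip)

theorem run_record_of_le (h : σ varMax 0 ≤ σ varSetWt 0) (h' : σ varSetWt 0 < σ varBest 0) :
    marked n arrOut (record.run n σ) = marked n arrSet σ ∧
      record.run n σ varBest 0 = σ varSetWt 0 := by
  have hrun : record.run n σ = (write varBest (.const 0) (.var varSetWt)).run n
      ((fill arrOut (.cell arrSet varIdx)).run n σ) :=
    (if_neg (not_lt.2 h)).trans (if_pos h')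
  rw [hrun]
  constructor
  · rw [marked_congr (run_of_not_writes _ rfl _)]
    ext v
    have := run_fill (σ := σ) (e := .cell arrSet varIdx) (a := arrOut) (fun i => σ arrSet i)
      (by decide) (fun i _ τ hτ hframe => by
        simp only [Expr.eval, hτ, hframe arrSet (by decide) (by decide)]) v v.2
    simp only [marked, Set.mem_ofPred_eq, this]
  · simp only [run, Expr.eval, Memory.set_self, if_true]
    rw [run_of_not_writes _ rfl]

theorem run_record_of_not (h : ¬ (σ varMax 0 ≤ σ varSetWt 0 ∧ σ varSetWt 0 < σ varBest 0)) :
    record.run n σ = σ := by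
  by_cases g : (Expr.var varSetWt).eval σ < (Expr.var varMax).eval σ
  · exact if_pos g
  · exact (if_neg g).trans (if_neg fun h' => h ⟨not_lt.1 g, h'⟩)

/-- Add the chosen eligible vertex to the current set. -/
def extend : Cmd :=
  .ifLt (.const 0) (.var varKey) (.write arrSet (.var varArg) (.const 1)) .skip

/-- One step of the greedy algorithm. -/
def step : Cmd :=
  .seq scan (.seq (sumMask varSetWt arrSet arrWt) (.seq record extend))

end Cmd

/-- The best set found so far is a connected safe set, and its weight is stored. -/
def Sound {n : ℕ} (T : SimpleGraph (Fin n)) (w : Fin n → ℕ) (σ : Memory) : Prop :=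
  IsConnectedSafe T w (marked n arrOut σ) ∧ weight w (marked n arrOut σ) = σ varBest 0

theorem Sound.congr (h : Sound T w σ) (h3 : τ arrOut = σ arrOut) (h8 : τ varBest = σ varBest) :
    Sound T w τ := by
  unfold Sound
  rw [marked_congr h3, h8]
  exact h

namespace Cmd

/-- The test is applied to `S` before it is extended. Soundness holds for every guess; only
connectivity of `S` and w ≤ p are needed. -/
theorem run_step (hT : T.Connected) (hσ : Ctx T w S p θ σ) (hS : (T.induce S).Connected)
    (hwp : ∀ v, w v ≤ p v) (hs : Sound T w σ) :
    Sound T w (step.run n σ) ∧ step.run n σ varBest 0 ≤ σ varBest 0 ∧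
    ((∀ v ∉ S, weight p (comp T S v) ≤ weight w S) → step.run n σ varBest 0 ≤ weight w S) ∧
    (((∀ v, ¬ Eligible T w p θ S v) ∧ Ctx T w S p θ (step.run n σ)) ∨
      ∃ b, Eligible T w p θ S b ∧
        (∀ v, Eligible T w p θ S v → weight p (comp T S v) ≤ weight p (comp T S b)) ∧
        Ctx T w (insert b S) p θ (step.run n σ)) := by
  have hrun : step.run n σ = extend.run n
      (record.run n ((sumMask varSetWt arrSet arrWt).run n (scan.run n σ))) := rfl
  obtain ⟨h1, h2, h3, h4⟩ := run_scan hσ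
  have c1 := hσ.run scan rfl rfl rfl rfl rfl rfl
  have s1 : Sound T w (scan.run n σ) :=
    hs.congr (run_of_not_writes _ rfl _) (run_of_not_writes _ rfl _)
  have b1 : scan.run n σ varBest 0 = σ varBest 0 := by rw [run_of_not_writes _ rfl]
  rw [hrun]
  generalize scan.run n σ = σ₁ at *
  have e2 : (sumMask varSetWt arrSet arrWt).run n σ₁ varSetWt 0 = weight w S := by
    rw [run_sumMask _ (by decide) (by decide) (by decide) (by decide) (by decide),
      c1.toHolds.vals_eq, c1.set]
  have c2 := c1.run (sumMask varSetWt arrSet arrWt) rfl rfl rfl rfl rfl rfl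
  have s2 : Sound T w ((sumMask varSetWt arrSet arrWt).run n σ₁) :=
    s1.congr (run_of_not_writes _ rfl _) (run_of_not_writes _ rfl _)
  have b2 : (sumMask varSetWt arrSet arrWt).run n σ₁ varBest 0 = σ varBest 0 := by
    rw [run_of_not_writes _ rfl, b1]
  have m2 : (sumMask varSetWt arrSet arrWt).run n σ₁ varMax = σ₁ varMax :=
    run_of_not_writes _ rfl _
  have k2 : (sumMask varSetWt arrSet arrWt).run n σ₁ varKey = σ₁ varKey :=
    run_of_not_writes _ rfl _
  have a2 : (sumMask varSetWt arrSet arrWt).run n σ₁ varArg = σ₁ varArg :=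
    run_of_not_writes _ rfl _
  rw [← m2] at h1 h2
  rw [← k2] at h3 h4
  rw [← a2] at h4
  generalize (sumMask varSetWt arrSet arrWt).run n σ₁ = σ₂ at *
  have c3 := c2.run record rfl rfl rfl rfl rfl rfl
  have k3 : record.run n σ₂ varKey = σ₂ varKey := run_of_not_writes _ rfl _
  have a3 : record.run n σ₂ varArg = σ₂ varArg := run_of_not_writes _ rfl _
  have s3 : Sound T w (record.run n σ₂) ∧ record.run n σ₂ varBest 0 ≤ σ varBest 0 ∧
      ((∀ v ∉ S, weight p (comp T S v) ≤ weight w S) →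
        record.run n σ₂ varBest 0 ≤ weight w S) := by
    by_cases h : σ₂ varMax 0 ≤ σ₂ varSetWt 0 ∧ σ₂ varSetWt 0 < σ₂ varBest 0
    · obtain ⟨g1, g2⟩ := run_record_of_le (n := n) h.1 h.2
      unfold Sound
      rw [g1, g2, c2.set, e2]
      rw [e2] at h
      refine ⟨⟨(isConnectedSafe_iff hT).2 ⟨hS, fun v hv => ?_⟩, rfl⟩, ?_, fun _ => le_rfl⟩
      -- The test bounds p-weights, hence also w-weights.
      · exact (weight_mono_fun fun x _ => hwp x).trans ((h1 v hv).trans h.1)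
      · omega
    · rw [run_record_of_not h]
      refine ⟨s2, b2.le, fun hsafe => ?_⟩
      have := h2 _ hsafe
      rw [e2] at h
      exact not_lt.1 fun h' => h ⟨this, h'⟩
  rw [← k3] at h3 h4
  rw [← a3] at h4
  generalize record.run n σ₂ = σ₃ at *
  have s4 : Sound T w (extend.run n σ₃) :=
    s3.1.congr (run_of_not_writes _ rfl _) (run_of_not_writes _ rfl _)
  have b4 : extend.run n σ₃ varBest 0 = σ₃ varBest 0 := by rw [run_of_not_writes _ rfl]
  rw [b4]
  refine ⟨s4, s3.2.1, s3.2.2, ?_⟩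
  by_cases hk : 0 < σ₃ varKey 0
  · obtain ⟨b, hb, hbE, hbk⟩ := h4 hk
    have hrun : extend.run n σ₃ = σ₃.set arrSet b 1 := by
      have : extend.run n σ₃ = (write arrSet (.var varArg) (.const 1)).run n σ₃ := if_pos hk
      rw [this]
      simp only [run, Expr.eval, hb]
    refine Or.inr ⟨b, hbE, fun v hv => ?_, ?_⟩
    · have := h3 v hv
      omega
    · rw [hrun]
      refine ⟨c3.toHolds.congr ?_ ?_ ?_, ?_, ?_, ?_⟩
      · exact Memory.set_of_ne _ _ _ (by decide)
      · exact Memory.set_of_ne _ _ _ (by decide)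
      · exact Memory.set_of_ne _ _ _ (by decide)
      · rw [marked_set_one, c3.set]
      · rw [vals_set_of_ne _ _ (by decide), c3.pen]
      · rw [Memory.set_of_ne _ _ _ (by decide), Memory.set_of_ne _ _ _ (by decide), c3.root]
  · refine Or.inl ⟨fun v hv => hk (by have := h3 v hv; omega), ?_⟩
    have hrun : extend.run n σ₃ = σ₃ := if_neg hk
    rw [hrun]
    exact c3

end Cmd

end Step

/-- The memory contains the graph, the weights, the total weight plus one, and a connected safe
set together with its weight. -/
structure Ready {n : ℕ} (T : SimpleGraph (Fin n)) (w : Fin n → ℕ) (σ : Memory) : Prop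
    extends Holds T w σ where
  sound : Sound T w σ
  big : σ varBig 0 = weight w Set.univ + 1

theorem Ready.congr {n : ℕ} {T : SimpleGraph (Fin n)} {w : Fin n → ℕ} {σ τ : Memory}
    (h : Ready T w σ) (h1 : τ arrWt = σ arrWt) (h2 : τ arrAdj = σ arrAdj)
    (h3 : τ arrOut = σ arrOut) (h4 : τ arrMul = σ arrMul) (h8 : τ varBest = σ varBest)
    (h9 : τ varBig = σ varBig) : Ready T w τ :=
  ⟨h.toHolds.congr h1 h2 h4, h.sound.congr h3 h8, by rw [h9, h.big]⟩

theorem Ready.set {n : ℕ} {T : SimpleGraph (Fin n)} {w : Fin n → ℕ} {σ : Memory}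
    (h : Ready T w σ) {a : ℕ} (ha : varBig < a) (i v : ℕ) : Ready T w (σ.set a i v) :=
  h.congr (Memory.set_of_ne _ _ _ (by omega)) (Memory.set_of_ne _ _ _ (by omega))
    (Memory.set_of_ne _ _ _ (by omega)) (Memory.set_of_ne _ _ _ (by omega))
    (Memory.set_of_ne _ _ _ (by omega)) (Memory.set_of_ne _ _ _ (by omega))

/-! ### The search over all roots and tuples. -/

section Search

variable {n k : ℕ} {T : SimpleGraph (Fin n)} {w : Fin n → ℕ} {σ : Memory}

namespace Cmd

/-- Penalize the vertices in the first `k` cells of the current tuple. -/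
def penalize : ℕ → Cmd
  | 0 => .skip
  | k + 1 => .seq (penalize k) (.write arrPen (.var (varTuple + k))
      (.add (.cell arrWt (varTuple + k)) (.var varBig)))

theorem writes_penalize {a : ℕ} (h : a ≠ arrPen) (k : ℕ) : (penalize k).writes a = false := by
  induction k with
  | zero => rfl
  | succ k ih => simp [penalize, writes, ih, h]

open Classical in
theorem run_penalize (k v : ℕ) :
    (penalize k).run n σ arrPen v =
      if ∃ i < k, σ (varTuple + i) 0 = v then σ arrWt v + σ varBig 0 else σ arrPen v := by
  induction k with
  | zero => simp [penalize, run]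
  | succ k ih =>
    have hf : ∀ a, a ≠ arrPen → (penalize k).run n σ a = σ a := fun a h =>
      run_of_not_writes _ (writes_penalize h k) σ
    have hex : (∃ i < k + 1, σ (varTuple + i) 0 = v) ↔
        (∃ i < k, σ (varTuple + i) 0 = v) ∨ v = σ (varTuple + k) 0 := by
      constructor
      · rintro ⟨i, hi, h⟩
        rcases Nat.lt_succ_iff_lt_or_eq.1 hi with hi | rfl
        · exact Or.inl ⟨i, hi, h⟩
        · exact Or.inr h.symm
      · rintro (⟨i, hi, h⟩ | h)
        · exact ⟨i, by omega, h⟩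
        · exact ⟨k, by omega, h.symm⟩
    simp only [penalize, run, Expr.eval, Memory.set_self, ih, hf (varTuple + k) (by omega),
      hf arrWt (by omega), hf varBig (by omega)]
    by_cases h : v = σ (varTuple + k) 0
    · rw [if_pos h, if_pos (hex.2 (Or.inr h)), h]
    · rw [if_neg h]
      by_cases h' : ∃ i < k, σ (varTuple + i) 0 = v
      · rw [if_pos h', if_pos (hex.2 (Or.inl h'))]
      · rw [if_neg h', if_neg fun g => (hex.1 g).elim h' h]

/-- Start the greedy algorithm for the current root and the current tuple. -/
def init (k : ℕ) : Cmd :=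
  .seq (fill arrPen (.cell arrWt varIdx)) (.seq (penalize k)
    (.seq (fill arrSet (.const 0)) (.write arrSet (.var varRoot) (.const 1))))

theorem writes_init {a : ℕ} (h5 : a ≠ arrSet) (h7 : a ≠ arrPen) (h16 : a ≠ varIdx) :
    (init k).writes a = false := by
  simp [init, fill, writes, writes_penalize h7, h5, h7, h16]

open Classical in
theorem run_init (hσ : Holds T w σ) (r : Fin n) (hr : σ varRoot 0 = r) :
    Ctx T w {r} (fun v => if ∃ i < k, σ (varTuple + i) 0 = v then w v + σ varBig 0 else w v) (w r)
      ((init k).run n σ) := by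
  have hf : ∀ a, a ≠ arrSet → a ≠ arrPen → a ≠ varIdx → (init k).run n σ a = σ a :=
    fun a h5 h7 h16 => run_of_not_writes _ (writes_init h5 h7 h16) σ
  refine ⟨hσ.congr (hf _ (by decide) (by decide) (by decide))
    (hf _ (by decide) (by decide) (by decide)) (hf _ (by decide) (by decide) (by decide)),
    ?_, ?_, ?_⟩
  · have hrun : (init k).run n σ = (write arrSet (.var varRoot) (.const 1)).run n
      ((fill arrSet (.const 0)).run n ((penalize k).run n
        ((fill arrPen (.cell arrWt varIdx)).run n σ))) := rfl
    have hroot : (fill arrSet (.const 0)).run n ((penalize k).run n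
        ((fill arrPen (.cell arrWt varIdx)).run n σ)) varRoot 0 = r := by
      rw [run_of_not_writes _ rfl, run_of_not_writes _ (writes_penalize (by decide) k),
        run_of_not_writes _ rfl, hr]
    rw [hrun]
    generalize (penalize k).run n ((fill arrPen (.cell arrWt varIdx)).run n σ) = σ₁ at hroot
    simp only [run, Expr.eval, hroot, marked_set_one]
    have h0 : marked n arrSet ((fill arrSet (.const 0)).run n σ₁) = ∅ := by
      ext x
      simp [marked, run_fill (σ := σ₁) (e := .const 0) (a := arrSet) (fun _ => 0) (by decide)
        (fun _ _ _ _ _ => rfl) x x.2]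
    rw [h0, insert_empty_eq]
  · funext v
    have hrun : (init k).run n σ arrPen =
        (penalize k).run n ((fill arrPen (.cell arrWt varIdx)).run n σ) arrPen :=
      run_of_not_writes (a := arrPen)
        (.seq (fill arrSet (.const 0)) (.write arrSet (.var varRoot) (.const 1))) rfl
        ((penalize k).run n ((fill arrPen (.cell arrWt varIdx)).run n σ))
    have hpen : (fill arrPen (.cell arrWt varIdx)).run n σ arrPen v = σ arrWt v :=
      run_fill (σ := σ) (e := .cell arrWt varIdx) (a := arrPen) (fun i => σ arrWt i) (by decide)
        (fun i _ τ hτ hframe => by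
          simp only [Expr.eval, hτ, hframe arrWt (by decide) (by decide)]) v v.2
    have hf' : ∀ a, a ≠ arrPen → a ≠ varIdx →
        (fill arrPen (.cell arrWt varIdx)).run n σ a = σ a := fun a h h' =>
      run_of_not_writes _ (by simp [fill, writes, h, h']) σ
    simp only [vals, hrun, run_penalize, hpen, hf' arrWt (by decide) (by decide),
      hf' varBig (by decide) (by decide), hσ.wt]
    have ht : ∀ i, (fill arrPen (.cell arrWt varIdx)).run n σ (varTuple + i) = σ (varTuple + i) :=
      fun i => hf' _ (by omega) (by omega)
    simp only [ht]
  · rw [hf _ (by decide) (by decide) (by decide), hf _ (by decide) (by decide) (by decide), hr,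
      hσ.wt]

/-- The greedy algorithm for the current root and the current tuple. -/
def greedy (k : ℕ) : Cmd := .seq (init k) (.loop varStep step)

theorem writes_greedy_tuple (i : ℕ) : (greedy k).writes (varTuple + i) = false := by
  have h : ∀ a, a < varTuple → (varTuple + i == a) = false := fun a ha => by
    simp only [beq_eq_false_iff_ne]; omega
  have h2 : (Cmd.loop varStep step).writes (varTuple + i) = false := by
    simp [step, scan, examine, measure, reach, relax, fill, sumMask, updateMax, updateKey,
      nbrTest, record, extend, writes, h]
  have h1 : (init k).writes (varTuple + i) = false :=
    writes_init (by omega) (by omega) (by omega)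
  simp [greedy, writes.eq_3, h1, h2]

theorem writes_greedy {a : ℕ} (h5 : a ≠ arrSet) (h7 : a ≠ arrPen) (h16 : a ≠ varIdx)
    (h : (Cmd.loop varStep step).writes a = false) : (greedy k).writes a = false := by
  simp [greedy, writes.eq_3, writes_init h5 h7 h16, h]

/-- For a correct guess, after j steps either a good set has been recorded or the invariant holds
with more than j vertices in `S`. The latter is impossible for j = n, so n steps suffice. -/
theorem run_greedy (hT : T.IsTree) (hσ : Ready T w σ) (r : Fin n) (hr : σ varRoot 0 = r) :
    Ready T w ((greedy k).run n σ) ∧ (greedy k).run n σ varBest 0 ≤ σ varBest 0 ∧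
    ∀ O : Set (Fin n), IsConnectedSafe T w O → r ∈ O →
      (∀ i < k, ∃ v ∈ O, σ (varTuple + i) 0 = (v : ℕ)) →
      (∀ v ∈ O, (∃ i < k, σ (varTuple + i) 0 = (v : ℕ)) ∨
        (w v ≤ w r ∧ k * w r ≤ weight w O)) →
      k * (greedy k).run n σ varBest 0 ≤ (k + 1) * weight w O := by
  classical
  have c1 := run_init (k := k) hσ.toHolds r hr
  set p : Fin n → ℕ := fun v => if ∃ i < k, σ (varTuple + i) 0 = v then w v + σ varBig 0 else w v
    with hp
  have s1 : Sound T w ((init k).run n σ) := hσ.sound.congr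
    (run_of_not_writes _ (writes_init (by decide) (by decide) (by decide)) _)
    (run_of_not_writes _ (writes_init (by decide) (by decide) (by decide)) _)
  have b1 : (init k).run n σ varBest 0 = σ varBest 0 := by
    rw [run_of_not_writes _ (writes_init (by decide) (by decide) (by decide))]
  have hwp : ∀ v, w v ≤ p v := by
    intro v
    simp only [hp]
    split <;> omega
  have := run_loop (n := n) (x := varStep) (p := step) (σ := (init k).run n σ) (fun j τ =>
    ∃ S, Ctx T w S p (w r) τ ∧ (T.induce S).Connected ∧ Sound T w τ ∧
      τ varBest 0 ≤ σ varBest 0 ∧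
      ∀ O : Set (Fin n), IsConnectedSafe T w O → r ∈ O →
        (∀ i < k, ∃ v ∈ O, σ (varTuple + i) 0 = (v : ℕ)) →
        (∀ v ∈ O, (∃ i < k, σ (varTuple + i) 0 = (v : ℕ)) ∨
          (w v ≤ w r ∧ k * w r ≤ weight w O)) →
        k * τ varBest 0 ≤ (k + 1) * weight w O ∨
          (GreedyInv T w p k O r S ∧ j < S.ncard)) ?_ ?_
  · obtain ⟨S, c2, -, s2, b2, h2⟩ := this
    have hf : ∀ a, a ≠ arrSet → a ≠ arrPen → a ≠ varIdx →
        (Cmd.loop varStep step).writes a = false → (greedy k).run n σ a = σ a :=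
      fun a h5 h7 h16 h => run_of_not_writes _ (writes_greedy h5 h7 h16 h) σ
    refine ⟨⟨c2.toHolds, s2, ?_⟩, b2, fun O hO hrO h h' => ?_⟩
    · rw [hf _ (by decide) (by decide) (by decide) rfl, hσ.big]
    · refine (h2 O hO hrO h h').resolve_right fun h => ?_
      have := Set.ncard_le_card S
      rw [Nat.card_fin] at this
      omega
  · refine ⟨{r}, c1.congr ?_ ?_ ?_ ?_ ?_ ?_, ?_, s1.congr ?_ ?_, ?_, fun O _ hrO _ _ =>
      Or.inr ⟨greedyInv_singleton hrO, by simp⟩⟩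
    any_goals exact Memory.set_of_ne _ _ _ (by decide)
    · exact SimpleGraph.Connected.mk SimpleGraph.Preconnected.of_subsingleton
    · rw [Memory.set_of_ne _ _ _ (by decide), b1]
  · rintro j hj τ hτ hframe ⟨S, c2, hS, s2, b2, h2⟩
    obtain ⟨s3, b3, t3, h3⟩ := run_step hT.connected c2 hS hwp s2
    have hset : ∀ a, a ≠ varStep → (step.run n τ).set varStep 0 (j + 1) a = step.run n τ a :=
      fun a h => Memory.set_of_ne _ _ _ h
    have hc : ∀ {S}, Ctx T w S p (w r) (step.run n τ) →
        Ctx T w S p (w r) ((step.run n τ).set varStep 0 (j + 1)) := fun h =>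
      h.congr (hset _ (by decide)) (hset _ (by decide)) (hset _ (by decide)) (hset _ (by decide))
        (hset _ (by decide)) (hset _ (by decide))
    have s4 : Sound T w ((step.run n τ).set varStep 0 (j + 1)) :=
      s3.congr (hset _ (by decide)) (hset _ (by decide))
    have key : ∀ O : Set (Fin n), IsConnectedSafe T w O → r ∈ O →
        (∀ i < k, ∃ v ∈ O, σ (varTuple + i) 0 = (v : ℕ)) →
        (∀ v ∈ O, (∃ i < k, σ (varTuple + i) 0 = (v : ℕ)) ∨
          (w v ≤ w r ∧ k * w r ≤ weight w O)) →
        k * step.run n τ varBest 0 ≤ (k + 1) * weight w O ∨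
          (j < S.ncard ∧ (∃ v, Eligible T w p (w r) S v) ∧
            ∀ b, Eligible T w p (w r) S b →
              (∀ v, Eligible T w p (w r) S v →
                weight p (comp T S v) ≤ weight p (comp T S b)) →
              GreedyInv T w p k O r (insert b S)) := by
      intro O hO hrO h h'
      rcases h2 O hO hrO h h' with hle | ⟨hinv, hcard⟩
      · exact Or.inl ((Nat.mul_le_mul_left _ b3).trans hle)
      -- If the test succeeds, `S` is good enough by the invariant; otherwise the greedy extension
      -- applies.
      · by_cases hsafe : ∀ v ∉ S, weight p (comp T S v) ≤ weight w S
        · exact Or.inl ((Nat.mul_le_mul_left _ (t3 hsafe)).trans hinv.2.1)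
        · refine Or.inr ⟨hcard, greedyInv_insert hT (B := σ varBig 0)
            (H := {v | ∃ i < k, σ (varTuple + i) 0 = (v : ℕ)}) hO ?_ hrO (fun v hv => if_pos hv)
            (fun v hv => if_neg hv) (by rw [hσ.big]; exact Nat.lt_succ_self _) h' hinv hsafe⟩
          rintro v ⟨i, hi, hv⟩
          obtain ⟨u, hu, hu'⟩ := h i hi
          obtain rfl : v = u := Fin.ext (hv.symm.trans hu')
          exact hu
    rw [hset varBest (by decide)]
    rcases h3 with ⟨hno, c3⟩ | ⟨b, hb, hmax, c3⟩
    · refine ⟨S, hc c3, hS, s4, b3.trans b2, fun O hO hrO h h' => Or.inl ?_⟩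
      exact (key O hO hrO h h').resolve_right fun h => h.2.1.elim hno
    · obtain ⟨u, hu, hub⟩ := hb.2.1
      refine ⟨insert b S, hc c3, connected_insert hS hu hub, s4, b3.trans b2,
        fun O hO hrO h h' => (key O hO hrO h h').imp_right fun hk => ⟨hk.2.2 b hb hmax, ?_⟩⟩
      rw [Set.ncard_insert_of_notMem hb.1]
      exact Nat.succ_lt_succ hk.1

/-- Run `c` for all values of the first `j` cells of the tuple. -/
def nest (c : Cmd) : ℕ → Cmd
  | 0 => c
  | j + 1 => .loop (varTuple + j) (nest c j)

theorem writes_nest {c : Cmd} {a : ℕ} (hc : c.writes a = false) :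
    ∀ j, (∀ i < j, a ≠ varTuple + i) → (nest c j).writes a = false
  | 0, _ => hc
  | j + 1, h => by
    have h1 := h j (Nat.lt_succ_self j)
    have h2 := writes_nest hc j fun i hi => h i (hi.trans (Nat.lt_succ_self j))
    simp [nest, writes, h1, h2]

theorem ok_nest {c : Cmd} (hc : c.ok = true) (hw : ∀ i, c.writes (varTuple + i) = false) :
    ∀ j, (nest c j).ok = true
  | 0 => hc
  | j + 1 => by
    simp only [nest, ok, Bool.and_eq_true, Bool.not_eq_true']
    exact ⟨writes_nest (hw j) j fun i hi => by omega, ok_nest hc hw j⟩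

theorem size_nest (c : Cmd) : ∀ j, (nest c j).size = c.size + 19 * j
  | 0 => rfl
  | j + 1 => by rw [nest, size, size_nest c j]; ring

theorem depth_nest (c : Cmd) : ∀ j, (nest c j).depth = c.depth + j
  | 0 => rfl
  | j + 1 => by rw [nest, depth, depth_nest c j]; ring

theorem run_nest_of_invariant {c : Cmd} {I : Memory → Prop}
    (hI : ∀ σ i v, I σ → I (σ.set (varTuple + i) 0 v)) (hcI : ∀ σ, I σ → I (c.run n σ)) (j : ℕ) :
    ∀ σ, I σ → I ((nest c j).run n σ) := by
  induction j with
  | zero => exact hcI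
  | succ j ih =>
    exact fun σ hσ =>
      run_loop (fun _ τ => I τ) (hI _ _ _ hσ) fun i _ τ _ _ hτ => hI _ _ _ (ih τ hτ)

/-- If `c` preserves `I` and `G`, and if `c` achieves `G` for the tuple `h`, then the nest of loops
over all tuples achieves `G`. -/
theorem run_nest_of_tuple {c : Cmd} (h : ℕ → ℕ) (hlt : ∀ i < k, h i < n) {I G : Memory → Prop}
    (hI : ∀ σ i v, I σ → I (σ.set (varTuple + i) 0 v))
    (hG : ∀ σ i v, G σ → G (σ.set (varTuple + i) 0 v))
    (hcI : ∀ σ, I σ → I (c.run n σ)) (hcG : ∀ σ, G σ → G (c.run n σ))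
    (hc : ∀ σ, I σ → (∀ i < k, σ (varTuple + i) 0 = h i) → G (c.run n σ))
    (hw : ∀ i, c.writes (varTuple + i) = false) (j : ℕ) (hj : j ≤ k) (σ : Memory) (hσ : I σ)
    (hσh : ∀ i < k, j ≤ i → σ (varTuple + i) 0 = h i) : G ((nest c j).run n σ) := by
  induction j generalizing σ with
  | zero => exact hc σ hσ fun i hi => hσh i hi (Nat.zero_le i)
  | succ j ih =>
    -- The goal `G` is achieved in the round where the counter equals `h j`, and the other rounds
    -- preserve it.
    have := run_loop (n := n) (x := varTuple + j) (p := nest c j) (σ := σ)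
      (fun i τ => I τ ∧ (h j < i → G τ)) ⟨hI _ _ _ hσ, fun h => absurd h (Nat.not_lt_zero _)⟩
      fun i hi τ hτ hframe hinv =>
        ⟨hI _ _ _ (run_nest_of_invariant hI hcI j τ hinv.1), fun hlt => hG _ _ _ ?_⟩
    · exact this.2 (hlt j (by omega))
    · rcases Nat.lt_succ_iff_lt_or_eq.1 hlt with hlt | heq
      · exact run_nest_of_invariant hG hcG j τ (hinv.2 hlt)
      · refine ih (by omega) τ hinv.1 fun l hl hjl => ?_
        rcases Nat.lt_or_eq_of_le hjl with hjl | rfl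
        · rw [hframe _ (writes_nest (hw l) (j + 1) fun i hi => by omega), hσh l hl hjl]
        · rw [hτ, heq]

/-- Run the greedy algorithm for all roots and all tuples of length `k`. -/
def search (k : ℕ) : Cmd := .loop varRoot (nest (greedy k) k)

/-- The guess given by `exists_heavy` for an optimal set occurs among the rounds; before and after
it, the recorded set stays sound and never gets heavier. -/
theorem run_search (hT : T.IsTree) (hσ : Ready T w σ) (hk : 0 < k) :
    Sound T w ((search k).run n σ) ∧ k * (search k).run n σ varBest 0 ≤ (k + 1) * cs T w := by
  obtain ⟨O, hO, hOcs⟩ := exists_isConnectedSafe_weight_eq_cs hT.connected w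
  have hne : O.Nonempty := by
    obtain ⟨⟨x, hx⟩⟩ := hO.1.nonempty
    exact ⟨x, hx⟩
  obtain ⟨r, h, hrO, hhO, hh⟩ := exists_heavy w hk hne
  have hroot : ∀ σ, (greedy k).run n σ varRoot = σ varRoot :=
    run_of_not_writes _ (writes_greedy (by decide) (by decide) (by decide) rfl)
  have hset : ∀ (σ : Memory) i v a, a < varTuple → σ.set (varTuple + i) 0 v a = σ a :=
    fun σ i v a ha => Memory.set_of_ne _ _ _ (by omega)
  have hI : ∀ (u : Fin n) (σ : Memory) i v, Ready T w σ ∧ σ varRoot 0 = u →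
      Ready T w (σ.set (varTuple + i) 0 v) ∧ σ.set (varTuple + i) 0 v varRoot 0 = u :=
    fun u σ i v hσ => ⟨hσ.1.set (by omega) _ _, by rw [hset _ _ _ _ (by decide), hσ.2]⟩
  have hcI : ∀ (u : Fin n) (σ : Memory), Ready T w σ ∧ σ varRoot 0 = u →
      Ready T w ((greedy k).run n σ) ∧ (greedy k).run n σ varRoot 0 = u :=
    fun u σ hσ => ⟨(run_greedy hT hσ.1 u hσ.2).1, by rw [hroot, hσ.2]⟩
  have hG : ∀ (u : Fin n) (σ : Memory) i v, (Ready T w σ ∧ σ varRoot 0 = u) ∧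
      k * σ varBest 0 ≤ (k + 1) * weight w O →
      (Ready T w (σ.set (varTuple + i) 0 v) ∧ σ.set (varTuple + i) 0 v varRoot 0 = u) ∧
      k * σ.set (varTuple + i) 0 v varBest 0 ≤ (k + 1) * weight w O :=
    fun u σ i v hσ => ⟨hI u σ i v hσ.1, by rw [hset _ _ _ _ (by decide)]; exact hσ.2⟩
  have hcG : ∀ (u : Fin n) (σ : Memory), (Ready T w σ ∧ σ varRoot 0 = u) ∧
      k * σ varBest 0 ≤ (k + 1) * weight w O →
      (Ready T w ((greedy k).run n σ) ∧ (greedy k).run n σ varRoot 0 = u) ∧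
      k * (greedy k).run n σ varBest 0 ≤ (k + 1) * weight w O :=
    fun u σ hσ => ⟨hcI u σ hσ.1,
      (Nat.mul_le_mul_left _ (run_greedy hT hσ.1.1 u hσ.1.2).2.1).trans hσ.2⟩
  have hc : ∀ σ : Memory, Ready T w σ ∧ σ varRoot 0 = r →
      (∀ i < k, σ (varTuple + i) 0 = h i) →
      (Ready T w ((greedy k).run n σ) ∧ (greedy k).run n σ varRoot 0 = r) ∧
      k * (greedy k).run n σ varBest 0 ≤ (k + 1) * weight w O := by
    intro σ hσ hσh
    refine ⟨hcI r σ hσ, (run_greedy hT hσ.1 r hσ.2).2.2 O hO hrO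
      (fun i hi => ⟨h i, hhO i, hσh i hi⟩) fun v hv => (hh v hv).imp_left ?_⟩
    rintro ⟨i, hi, rfl⟩
    exact ⟨i, hi, hσh i hi⟩
  have := run_loop (n := n) (x := varRoot) (p := nest (greedy k) k) (σ := σ)
    (fun j τ => Ready T w τ ∧ ((r : ℕ) < j → k * τ varBest 0 ≤ (k + 1) * weight w O))
    ⟨hσ.set (by decide) _ _, fun h => absurd h (Nat.not_lt_zero _)⟩ ?_
  · rw [← hOcs]
    exact ⟨this.1.sound, this.2 r.2⟩
  · intro j hj τ hτ _ hinv
    rw [Memory.set_of_ne _ _ _ (show varBest ≠ varRoot by decide)]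
    refine ⟨Ready.set (run_nest_of_invariant (hI ⟨j, hj⟩) (hcI ⟨j, hj⟩) k τ
      ⟨hinv.1, hτ⟩).1 (by decide) _ _, fun hlt => ?_⟩
    rcases Nat.lt_succ_iff_lt_or_eq.1 hlt with hlt | heq
    · exact (run_nest_of_invariant (hG ⟨j, hj⟩) (hcG ⟨j, hj⟩) k τ
        ⟨⟨hinv.1, hτ⟩, hinv.2 hlt⟩).2
    · exact (run_nest_of_tuple (fun i => h i) (fun i _ => (h i).2) (hI r) (hG r) (hcI r) (hcG r)
        hc writes_greedy_tuple k le_rfl τ ⟨hinv.1, hτ.trans heq.symm⟩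
        fun i hi hki => absurd hi (not_lt.2 hki)).2

/-- Prepare the memory: tabulate the multiples of `n`, and start with the set of all vertices as
best set. -/
def prepare : Cmd :=
  .seq (.loop varIdx (.write arrMul (.add (.var varIdx) (.const 1))
      (.add (.cell arrMul varIdx) (.var 0))))
    (.seq (fill arrOut (.const 1)) (.seq (sumMask varBest arrOut arrWt)
      (.write varBig (.const 0) (.add (.var varBest) (.const 1)))))

/-- The machine cannot multiply, so row offsets of the adjacency matrix come from a table built by
repeated addition. -/
theorem run_multiples : ∀ a ≤ n, (Cmd.loop varIdx (.write arrMul (.add (.var varIdx) (.const 1))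
    (.add (.cell arrMul varIdx) (.var 0)))).run n (input T w) arrMul a = n * a := by
  refine run_loop (n := n) (fun j τ => ∀ a ≤ j, τ arrMul a = n * a) ?_ ?_
  · intro a ha
    obtain rfl : a = 0 := by omega
    simp [Memory.set, input]
  · intro j hj τ hτ hframe hI a ha
    have h0 : τ 0 0 = n := by
      rw [hframe 0 rfl]
      simp [input]
    rw [Memory.set_of_ne _ _ _ (by decide)]
    simp only [run, Expr.eval, hτ, h0, Memory.set_self]
    split
    · next h => rw [h, hI j le_rfl]; ring
    · exact hI a (by omega)

theorem ready_prepare (hT : T.Connected) : Ready T w (prepare.run n (input T w)) := by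
  have hmul : ∀ a : Fin n, prepare.run n (input T w) arrMul a = n * a := fun a =>
    (congrFun (run_of_not_writes (.seq (fill arrOut (.const 1))
      (.seq (sumMask varBest arrOut arrWt)
        (.write varBig (.const 0) (.add (.var varBest) (.const 1))))) rfl _) a).trans
      (run_multiples a a.2.le)
  have hwt : vals n arrWt (input T w) = w := by
    funext v
    simp [vals, input]
  have hholds : Holds T w (prepare.run n (input T w)) := by
    refine ⟨fun v => ?_, fun u v => ?_⟩
    · rw [run_of_not_writes _ rfl]
      exact congrFun hwt v
    · rw [hmul, run_of_not_writes _ rfl]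
      simp only [input, ne_eq, ite_eq_right_iff, one_ne_zero, imp_false, not_not]
      constructor
      · rintro ⟨u', v', h, heq⟩
        have hn : 0 < n := u.pos
        -- Quotient and remainder modulo n recover row and column from the matrix index.
        have h1 := congrArg (· / n) heq
        have h2 := congrArg (· % n) heq
        simp only [Nat.mul_add_div hn, Nat.div_eq_of_lt v.2, Nat.div_eq_of_lt v'.2, add_zero,
          Nat.mul_add_mod, Nat.mod_eq_of_lt v.2, Nat.mod_eq_of_lt v'.2] at h1 h2
        rwa [Fin.ext h1, Fin.ext h2]
      · exact fun h => ⟨u, v, h, rfl⟩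
  have hrun : prepare.run n (input T w) =
      (write varBig (.const 0) (.add (.var varBest) (.const 1))).run n
        ((sumMask varBest arrOut arrWt).run n ((fill arrOut (.const 1)).run n
          ((Cmd.loop varIdx (.write arrMul (.add (.var varIdx) (.const 1))
            (.add (.cell arrMul varIdx) (.var 0)))).run n (input T w)))) := rfl
  have hwt1 : vals n arrWt ((fill arrOut (.const 1)).run n
      ((Cmd.loop varIdx (.write arrMul (.add (.var varIdx) (.const 1))
        (.add (.cell arrMul varIdx) (.var 0)))).run n (input T w))) = w := by
    rw [vals_congr (run_of_not_writes _ rfl _), vals_congr (run_of_not_writes _ rfl _), hwt]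
  have hout : marked n arrOut ((fill arrOut (.const 1)).run n
      ((Cmd.loop varIdx (.write arrMul (.add (.var varIdx) (.const 1))
        (.add (.cell arrMul varIdx) (.var 0)))).run n (input T w))) = Set.univ := by
    ext v
    simp [marked, run_fill (e := .const 1) (a := arrOut) (fun _ => 1) (by decide)
      (fun _ _ _ _ _ => rfl) v v.2]
  generalize (fill arrOut (.const 1)).run n _ = σ₁ at hrun hwt1 hout
  have hbest : (sumMask varBest arrOut arrWt).run n σ₁ varBest 0 = weight w Set.univ := by
    rw [run_sumMask _ (by decide) (by decide) (by decide) (by decide) (by decide), hwt1, hout]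
  have hout' : marked n arrOut (prepare.run n (input T w)) = Set.univ := by
    rw [hrun, marked_congr (run_of_not_writes _ rfl _), marked_congr (run_of_not_writes _ rfl _),
      hout]
  refine ⟨hholds, ⟨?_, ?_⟩, ?_⟩
  · rw [hout']
    exact isConnectedSafe_univ hT w
  · rw [hout', hrun, run_of_not_writes _ rfl, hbest]
  · rw [hrun]
    simp only [run, Expr.eval, Memory.set_self, if_true, hbest]

/-- The approximation algorithm. -/
def main (k : ℕ) : Cmd := .seq prepare (search k)

/-! ### Well-formedness and running time of the whole algorithm. -/

theorem ok_penalize (k : ℕ) : (penalize k).ok = true := by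
  induction k with
  | zero => rfl
  | succ k ih => simp [penalize, ok, ih]

theorem ok_main (k : ℕ) : (main k).ok = true := by
  have h1 : (Cmd.loop varStep step).ok = true := rfl
  have h2 : (fill arrPen (.cell arrWt varIdx)).ok = true := rfl
  have h3 : (fill arrSet (.const 0)).ok = true := rfl
  have h4 : (greedy k).ok = true := by
    simp [greedy, init, ok.eq_3, h1, h2, h3, ok_penalize, ok.eq_2]
  have h5 : (nest (greedy k) k).writes varRoot = false :=
    writes_nest (writes_greedy (by decide) (by decide) (by decide) rfl) k fun i _ => by omega
  have h6 : prepare.ok = true := rfl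
  simp [main, search, ok, h5, h6, ok_nest h4 writes_greedy_tuple]

theorem writes_main (k : ℕ) : (main k).writes 0 = false := by
  have h : (nest (greedy k) k).writes 0 = false :=
    writes_nest (writes_greedy (by decide) (by decide) (by decide) rfl) k fun i _ => by omega
  have h' : prepare.writes 0 = false := rfl
  simp [main, search, writes, h, h']

theorem size_penalize (k : ℕ) : (penalize k).size = 9 * k + 1 := by
  induction k with
  | zero => rfl
  | succ k ih => rw [penalize, size, ih, size, Expr.cost, Expr.cost, Expr.cost, Expr.cost,
      Expr.cost, Expr.cost, Expr.cost, Expr.cost]; ring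

/-- Each tuple position costs 19 for its loop and 9 for its penalizing write; the rest of the
program does not depend on k. -/
theorem size_main : ∃ A, ∀ k, (main k).size = A + 28 * k := by
  refine ⟨prepare.size + (fill arrPen (.cell arrWt varIdx)).size + 1 +
    (Cmd.seq (fill arrSet (.const 0)) (.write arrSet (.var varRoot) (.const 1))).size +
    (Cmd.loop varStep step).size + 19, fun k => ?_⟩
  simp only [main, search, size_nest, greedy, init, size.eq_3, size_penalize, size.eq_5]
  ring

theorem depth_penalize (k : ℕ) : (penalize k).depth = 0 := by
  induction k with
  | zero => rfl
  | succ k ih => simp [penalize, depth, ih]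

/-- Besides the k tuple loops, the deepest nest runs over root, step, vertex, round and both
endpoints of an edge. -/
theorem depth_main (k : ℕ) : (main k).depth = k + 6 := by
  have h1 : (Cmd.loop varStep step).depth = 5 := rfl
  have h2 : (init k).depth = 1 := by
    rw [init, depth, depth, depth_penalize]
    rfl
  have h3 : prepare.depth = 1 := rfl
  rw [main, depth, search, depth, depth_nest, greedy, depth, h1, h2, h3]
  omega

theorem exec_main (hT : T.IsTree) (hk : 0 < k) :
    ∃ τ t, Exec (main k).compile (input T w) τ t ∧ t ≤ (main k).size * n ^ (k + 6) ∧
      IsConnectedSafe T w (output n τ) ∧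
      k * weight w (output n τ) ≤ (k + 1) * cs T w := by
  obtain ⟨t, ht, hexec⟩ := exec_compile (n := n) (main k) (ok_main k) (writes_main k)
    (input T w) (by simp [input])
  have hn : 1 ≤ n := by
    obtain ⟨v⟩ := hT.connected.nonempty
    exact v.pos
  obtain ⟨h1, h2⟩ := run_search hT (ready_prepare (w := w) hT.connected) hk
  have hout : output n ((main k).run n (input T w)) =
    marked n arrOut ((search k).run n (prepare.run n (input T w))) := rfl
  refine ⟨_, t, hexec, ?_, hout ▸ h1.1, ?_⟩
  · rw [← depth_main]
    exact ht.trans (time_le hn _)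
  · rw [hout, h1.2]
    exact h2

end Cmd

end Search

end Ram

theorem theorem1 :
    ∃ C c : ℝ, ∀ ε : ℝ, 0 < ε →
      ∃ P : Ram.Program,
        ∀ (n : ℕ) (T : SimpleGraph (Fin n)) (w : Fin n → ℕ), T.IsTree →
          ∃ (σ : Ram.Memory) (t : ℕ),
            Ram.Exec P (Ram.input T w) σ t ∧
            (t : ℝ) ≤ C * (max 1 (1 / ε)) ^ 4 * (n : ℝ) ^ (c * max 1 (1 / ε)) ∧
            SafeSet.IsConnectedSafe T w (Ram.output n σ) ∧
            (SafeSet.weight w (Ram.output n σ) : ℝ) ≤ (1 + ε) * (SafeSet.cs T w : ℝ) := by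
  obtain ⟨A, hA⟩ := Ram.Cmd.size_main
  -- With m = max(1, 1/ε) and k = ⌈m⌉ one has k < m + 1 ≤ 2m. Hence A + 28k ≤ (A + 56) m and k + 6 ≤
  -- m + 7 ≤ 8m.
  refine ⟨A + 56, 8, fun ε hε => ?_⟩
  have hm1 : (1 : ℝ) ≤ max 1 (1 / ε) := le_max_left _ _
  have hmε : 1 / ε ≤ max 1 (1 / ε) := le_max_right _ _
  generalize max 1 (1 / ε) = m at hm1 hmε
  have hkm : m ≤ (⌈m⌉₊ : ℝ) := Nat.le_ceil m
  have hkm' : (⌈m⌉₊ : ℝ) < m + 1 := Nat.ceil_lt_add_one (by linarith)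
  have hk : 0 < ⌈m⌉₊ := Nat.ceil_pos.2 (by linarith)
  generalize ⌈m⌉₊ = k at hkm hkm' hk
  refine ⟨(Ram.Cmd.main k).compile, fun n T w hT => ?_⟩
  obtain ⟨σ, t, hexec, ht, hsafe, hw⟩ := Ram.Cmd.exec_main (w := w) hT hk
  refine ⟨σ, t, hexec, ?_, hsafe, ?_⟩
  · have hn : (1 : ℝ) ≤ n := by
      obtain ⟨v⟩ := hT.connected.nonempty
      exact_mod_cast v.pos
    have ht' : (t : ℝ) ≤ (A + 28 * k) * (n : ℝ) ^ (k + 6) := by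
      rw [hA] at ht
      exact_mod_cast ht
    have hpow : (n : ℝ) ^ (k + 6) ≤ (n : ℝ) ^ (8 * m) := by
      rw [← Real.rpow_natCast]
      refine Real.rpow_le_rpow_of_exponent_le hn ?_
      push_cast
      linarith
    have hcoef : (A + 28 * k : ℝ) ≤ (A + 56) * m ^ 4 := by
      have h4 : m ≤ m ^ 4 := le_self_pow₀ hm1 (by decide)
      have hA0 : (0 : ℝ) ≤ A := Nat.cast_nonneg A
      calc (A + 28 * k : ℝ) ≤ (A + 56) * m := by nlinarith
        _ ≤ (A + 56) * m ^ 4 := mul_le_mul_of_nonneg_left h4 (by linarith)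
    calc (t : ℝ) ≤ (A + 28 * k) * (n : ℝ) ^ (k + 6) := ht'
      _ ≤ ((A + 56) * m ^ 4) * (n : ℝ) ^ (8 * m) :=
        mul_le_mul hcoef hpow (by positivity) (by positivity)
  · have hw' : (k : ℝ) * SafeSet.weight w (Ram.output n σ) ≤ (k + 1) * SafeSet.cs T w := by
      exact_mod_cast hw
    have hkpos : (0 : ℝ) < k := by exact_mod_cast hk
    -- As k ≥ 1/ε, the factor (k + 1)/k is at most 1 + ε.
    have hkε : 1 ≤ k * ε := by
      have := (div_le_iff₀ hε).1 (hmε.trans hkm)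
      linarith
    have hcs : (0 : ℝ) ≤ SafeSet.cs T w := Nat.cast_nonneg _
    refine le_of_mul_le_mul_left ?_ hkpos
    nlinarith
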